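/- **Model.** Consider a single-location lost-sales system over replenishment cycles $n=1,2,\dots$ of $T\ge 1$ periods each, with $M\ge 2$ customer types with rewards $0<r_1<\dots<r_M$. Arrivals are i.i.d. over periods and cycles: in each period a type-$j$ customer arrives with probability $\lambda_j\ge 0$, and nobody arrives with probability $\lambda_0=1-\sum_{j=1}^M\lambda_j\ge 0$. Let $D^n$ be the number of arrivals in cycle $n$. Each customer wants one unit; customers who are not accepted are lost. Under *myopic offline fulfillment*, the arrivals of the current cycle are known and customers are accepted from the highest-reward type to the lowest until the cycle's inventory is used up. The profit of a cycle is the sum of the rewards of accepted customers minus $h>0$ per unit left at the end of the cycle. The lead time is $L\ge1$ cycles. * *Base-stock policy with level $S\in\mathbb Z_{\ge0}$:* at the start of each cycle, after the arrival of the order due then, an order is placed that raises the inventory position (on hand plus outstanding orders) to $S$; it arrives $L$ cycles later. The initial state is any state with nonnegative integer components and inventory position at most $S$. * *Constant-order policy with quantity $c\in\mathbb Z_{\ge0}$:* $c$ units arrive at the start of every cycle, and the first cycle starts with inventory $c$. A *long-run average* is the limit as $N\to\infty$ of the expected average over the first $N$ cycles; infinite values are allowed. Let $\pi_{\mathbf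 b}^{\mathrm{off}}$ and $\pi_{\mathbf c}^{\mathrm{off}}$ be the long-run average profits per cycle under myopic offline fulfillment of the base-stock policy with a profit-maximizing level $S$ and of the constant-order policy with a profit-maximizing quantity $c$. **Costs.** Let $C_{\mathbf b}^{\mathscr B,S}(h,b)$ be the long-run average cost per cycle of the base-stock policy with level $S$ when unmet demand is backordered, with cost $h$ per unit on hand and $b$ per unit backordered at the end of each cycle. Let $C_{\mathbf c}^{c}(h,p)$ be the long-run average cost per cycle of the constant-order policy with lost sales under myopic offline fulfillment, with cost $h$ per unit on hand at the end of each cycle and $p$ per lost sale. Over nonnegative integers, let $\bar S(h,p)$ be a minimizer of $S\mapsto C_{\mathbf b}^{\mathscr B,S}(h,p+Lh)$, $\underline S(h,p)$ a minimizer of $S\mapsto C_{\mathbf b}^{\mathscr B,S}(h,p/(L+1))$, and $c^*(h,p)$ a minimizer of $c\mapsto C_{\mathbf c}^{c}(h,p)$. Put $P_{n,k}=\binom{nT}{k}(1-\lambda_0)^k\lambda_0^{nT-k}$, $P_k=P_{L+1,k}$ and, with $\bar S=\bar S(h,p)$, $\underline S=\underline S(h,p)$, $c^*=c^*(h,p)$,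 $$\bar a_1(T,h,p,L)=h\sum_{k=0}^{\bar S}(\bar S-k)P_k+(p+Lh)\sum_{k=\bar S+1}^{(L+1)T}(k-\bar S)P_k,$$ $$\underline a_1(T,h,p,L)=h\sum_{k=0}^{\underline S}(\underline S-k)P_k+\frac{p}{L+1}\sum_{k=\underline S+1}^{(L+1)T}(k-\underline S)P_k,$$ $$a_2(T,h,p)=h\sum_{n=1}^{\infty}\sum_{k=0}^{nc^*}\Bigl(c^*-\frac kn\Bigr)P_{n,k}+pT(1-\lambda_0)-pc^*.$$ **Theorem.** All the long-run averages above exist (for every $S$, $c$ and all penalties $b,p>0$): those of base-stock policies are finite, the constant-order profit is finite or $-\infty$, and the constant-order cost is finite or $+\infty$. Profit-maximizing $S$ and $c$ and the cost minimizers (for all penalties $b,p>0$) exist. For every choice of them, the series in $a_2(T,h,r_1)$ and $a_2(T,h,r_M)$ converge, $\pi_{\mathbf b}^{\mathrm{off}}$ and $\pi_{\mathbf c}^{\mathrm{off}}$ are finite, and $$a_2(T,h,r_1)-\bar a_1(T,h,r_M,L)\ \le\ \pi_{\mathbf b}^{\mathrm{off}}-\pi_{\mathbf c}^{\mathrm{off}}\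 \le\ a_2(T,h,r_M)-\underline a_1(T,h,r_1,L).$$ -/

import Mathlib

open MeasureTheory ProbabilityTheory Filter Topology

namespace Replenishment

/-- Arrivals of one cycle of `T` periods: in each period either nobody arrives (`none`) or one
customer of a type `j : Fin M` arrives. Types are numbered by increasing reward. -/
abbrev CycleArrivals (M T : ℕ) := Fin T → Option (Fin M)

/-- An arrival path `ℋ` over all cycles; cycle `0` is the first cycle. -/
abbrev ArrivalPath (M T : ℕ) := ℕ → CycleArrivals M T

instance instMeasurableSpaceArrival (M : ℕ) : MeasurableSpace (Option (Fin M)) := ⊤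

/-- The random path `X` has i.i.d. arrivals over periods and cycles: type `j` arrives with
probability `lam j`, and nobody arrives with the remaining probability. -/
structure IsArrivalProcess {Ω : Type*} [MeasurableSpace Ω] {M T : ℕ} (P : Measure Ω)
    (lam : Fin M → ℝ) (X : Ω → ArrivalPath M T) : Prop where
  measurable : ∀ n t, Measurable fun ω => X ω n t
  indep : iIndepFun (fun (i : ℕ × Fin T) (ω : Ω) => X ω i.1 i.2) P
  law : ∀ n t j, P {ω | X ω n t = some j} = ENNReal.ofReal (lam j)

/-- Probability that no customer arrives in a period. -/
noncomputable def lam0 {M : ℕ} (lam : Fin M → ℝ) : ℝ := 1 - ∑ j, lam j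

section Cycle

variable {M T : ℕ}

/-- Total demand in a cycle. -/
def demand (d : CycleArrivals M T) : ℕ :=
  (Finset.univ.filter fun t => (d t).isSome).card

/-- Number of customers served before the customer of period `t` when higher-reward types go
first (and, within a type, earlier customers go first). -/
def ahead (d : CycleArrivals M T) (t : Fin T) : ℕ :=
  (Finset.univ.filter fun s => ∃ i ∈ d s, ∃ j ∈ d t, j < i ∨ (i = j ∧ s < t)).card

/-- The periods whose customer is accepted by the myopic offline algorithm started with inventory
`I`: customers are accepted from the highest-reward type to the lowest until inventory runs out. -/
def accepted (I : ℤ) (d : CycleArrivals M T) : Finset (Fin T) :=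
  Finset.univ.filter fun t => (d t).isSome ∧ (ahead d t : ℤ) < I

/-- Number of units sold in a cycle under myopic offline fulfillment. -/
def sold (I : ℤ) (d : CycleArrivals M T) : ℤ := (accepted I d).card

/-- Inventory left at the end of a cycle under myopic offline fulfillment. -/
def endInv (I : ℤ) (d : CycleArrivals M T) : ℤ := I - sold I d

/-- Per-cycle profit: rewards of accepted customers minus holding cost on the leftover. -/
noncomputable def cycleProfit (r : Fin M → ℝ) (h : ℝ) (I : ℤ) (d : CycleArrivals M T) : ℝ :=
  (∑ t ∈ accepted I d, (d t).elim 0 r) - h * (endInv I d : ℝ)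

/-- Per-cycle cost in the lost-sales system with a uniform penalty `p` per lost sale. -/
noncomputable def cycleLostSalesCost (h p : ℝ) (I : ℤ) (d : CycleArrivals M T) : ℝ :=
  h * (endInv I d : ℝ) + p * ((demand d : ℝ) - (sold I d : ℝ))

/-- Per-cycle cost in the backorder system with start-of-cycle net inventory `x`: holding cost `h`
per unit on hand and penalty `b` per unit backordered at the end of the cycle. -/
noncomputable def cycleBackorderCost (h b : ℝ) (x : ℤ) (d : CycleArrivals M T) : ℝ :=
  h * max ((x : ℝ) - demand d) 0 + b * max ((demand d : ℝ) - x) 0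

end Cycle

/-- State at the start of a cycle `n`, before ordering: the (net) inventory `inv`, which includes
the order arriving at cycle `n`, and `pipe l`, the order arriving at the start of cycle `n + l`,
for `1 ≤ l ≤ L - 1` (other values of `pipe` are never used). -/
structure StockState where
  inv : ℤ
  pipe : ℕ → ℤ

/-- Admissible initial states under base-stock level `S`: nonnegative integer components with
inventory position at most `S`. -/
structure StockState.Feasible (s : StockState) (L S : ℕ) : Prop where
  inv_nonneg : 0 ≤ s.inv
  pipe_nonneg : ∀ l ∈ Finset.Icc 1 (L - 1), 0 ≤ s.pipe l
  position_le : s.inv + ∑ l ∈ Finset.Icc 1 (L - 1), s.pipe l ≤ (S : ℤ)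

/-- The base-stock order placed at the start of a cycle; it arrives `L` cycles later. -/
def order (L S : ℕ) (s : StockState) : ℤ :=
  (S : ℤ) - s.inv - ∑ l ∈ Finset.Icc 1 (L - 1), s.pipe l

/-- The pipeline right after ordering. -/
def pipeAfterOrder (L S : ℕ) (s : StockState) (l : ℕ) : ℤ :=
  if l = L then order L S s else s.pipe l

/-- Next state under the base-stock policy when `out` units leave the (net) inventory. -/
def nextState (L S : ℕ) (s : StockState) (out : ℤ) : StockState where
  inv := s.inv - out + pipeAfterOrder L S s 1
  pipe := fun l => pipeAfterOrder L S s (l + 1)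

section System

variable {M T : ℕ}

/-- Base-stock states of the lost-sales system under myopic offline fulfillment. -/
def baseState (L S : ℕ) (s₀ : StockState) (H : ArrivalPath M T) : ℕ → StockState
  | 0 => s₀
  | n + 1 => nextState L S (baseState L S s₀ H n) (sold (baseState L S s₀ H n).inv (H n))

/-- Base-stock states of the backorder system, where all demand is deducted. -/
def backorderState (L S : ℕ) (s₀ : StockState) (H : ArrivalPath M T) : ℕ → StockState
  | 0 => s₀
  | n + 1 => nextState L S (backorderState L S s₀ H n) (demand (H n))

/-- Start-of-cycle inventory under the constant-order policy and myopic offline fulfillment. -/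
def constInv (c : ℕ) (H : ArrivalPath M T) : ℕ → ℤ
  | 0 => c
  | n + 1 => endInv (constInv c H n) (H n) + c

/-- Profit of cycle `n` under base-stock level `S` and myopic offline fulfillment. -/
noncomputable def baseProfit (r : Fin M → ℝ) (h : ℝ) (L : ℕ) (init : ℕ → StockState) (S : ℕ)
    (H : ArrivalPath M T) (n : ℕ) : ℝ :=
  cycleProfit r h (baseState L S (init S) H n).inv (H n)

/-- Profit of cycle `n` under constant orders `c` and myopic offline fulfillment. -/
noncomputable def constProfit (r : Fin M → ℝ) (h : ℝ) (c : ℕ)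
    (H : ArrivalPath M T) (n : ℕ) : ℝ :=
  cycleProfit r h (constInv c H n) (H n)

/-- Cost of cycle `n` in the backorder system under base-stock level `S`. -/
noncomputable def backorderCost (h b : ℝ) (L : ℕ) (init : ℕ → StockState) (S : ℕ)
    (H : ArrivalPath M T) (n : ℕ) : ℝ :=
  cycleBackorderCost h b (backorderState L S (init S) H n).inv (H n)

/-- Cost of cycle `n` under constant orders `c` with uniform lost-sales penalty `p`. -/
noncomputable def constCost (h p : ℝ) (c : ℕ) (H : ArrivalPath M T) (n : ℕ) : ℝ :=
  cycleLostSalesCost h p (constInv c H n) (H n)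

variable {Ω : Type*} [MeasurableSpace Ω]

/-- The expected average of `f` over the first `N` cycles tends to `v` as `N → ∞`. Infinite limits
are allowed, since too large a constant order makes the inventory grow without bound. -/
def HasLongRunAverage (P : Measure Ω) (X : Ω → ArrivalPath M T)
    (f : ArrivalPath M T → ℕ → ℝ) (v : EReal) : Prop :=
  Tendsto (fun N : ℕ =>
    (((1 / (N : ℝ)) * ∫ ω, ∑ n ∈ Finset.range N, f (X ω) n ∂P : ℝ) : EReal)) atTop (𝓝 v)

/-- `z` maximizes the long-run average of `f z` over all policy parameters `z : ℕ`. -/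
def IsProfitOptimal (P : Measure Ω) (X : Ω → ArrivalPath M T)
    (f : ℕ → ArrivalPath M T → ℕ → ℝ) (z : ℕ) : Prop :=
  ∃ v : EReal, HasLongRunAverage P X (f z) v ∧
    ∀ (z' : ℕ) (w : EReal), HasLongRunAverage P X (f z') w → w ≤ v

/-- `z` minimizes the long-run average of `f z` over all policy parameters `z : ℕ`. -/
def IsCostOptimal (P : Measure Ω) (X : Ω → ArrivalPath M T)
    (f : ℕ → ArrivalPath M T → ℕ → ℝ) (z : ℕ) : Prop :=
  ∃ v : EReal, HasLongRunAverage P X (f z) v ∧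
    ∀ (z' : ℕ) (w : EReal), HasLongRunAverage P X (f z') w → v ≤ w

end System

/-- Probability that the total demand over `n` cycles of `T` periods equals `k`, where `l0` is the
probability of no arrival in a period. -/
noncomputable def demandProb (T : ℕ) (l0 : ℝ) (n k : ℕ) : ℝ :=
  ((n * T).choose k : ℝ) * (1 - l0) ^ k * l0 ^ (n * T - k)

/-- The upper cost bound for base-stock policies, with `S` in the role of the backorder-optimal
level for penalty `p + L h`. -/
noncomputable def aBarOne (T : ℕ) (l0 h p : ℝ) (L S : ℕ) : ℝ :=
  h * (∑ k ∈ Finset.Icc 0 S, ((S : ℝ) - k) * demandProb T l0 (L + 1) k) +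
    (p + L * h) *
      ∑ k ∈ Finset.Icc (S + 1) ((L + 1) * T), ((k : ℝ) - S) * demandProb T l0 (L + 1) k

/-- The lower cost bound for base-stock policies, with `S` in the role of the backorder-optimal
level for penalty `p / (L + 1)`. -/
noncomputable def aUnderOne (T : ℕ) (l0 h p : ℝ) (L S : ℕ) : ℝ :=
  h * (∑ k ∈ Finset.Icc 0 S, ((S : ℝ) - k) * demandProb T l0 (L + 1) k) +
    p / (L + 1) *
      ∑ k ∈ Finset.Icc (S + 1) ((L + 1) * T), ((k : ℝ) - S) * demandProb T l0 (L + 1) k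

/-- The term of index `n + 1` of the series in the constant-order cost. -/
noncomputable def aTwoTerm (T : ℕ) (l0 : ℝ) (c n : ℕ) : ℝ :=
  ∑ k ∈ Finset.Icc 0 ((n + 1) * c), ((c : ℝ) - (k : ℝ) / ((n : ℝ) + 1)) * demandProb T l0 (n + 1) k

/-- The constant-order cost expression, with `c` in the role of the cost-optimal order. -/
noncomputable def aTwo (T : ℕ) (l0 h p : ℝ) (c : ℕ) : ℝ :=
  h * (∑' n : ℕ, aTwoTerm T l0 c n) + p * T * (1 - l0) - p * c

end Replenishment

open Replenishment

/-! Let `R` be the mean reward of all arrivals of a cycle. The profit of a cycle is the total reward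
minus the holding cost minus the reward of the rejected customers, and each rejected customer is
worth between `r₁` and `rM`. So for either policy the average profit lies between `R` minus the
lost-sales cost with penalty `rM` and `R` minus that with penalty `r₁`. In the difference of two
profits `R` cancels, and only uniform-penalty costs have to be evaluated or compared.

Base-stock policies: couple the lost-sales and backorder systems on the same arrivals. An order
placed in cycle `n` is available in cycle `n + L`, so the leftover there equals the backorder net
inventory plus the sales lost in cycles `n, ..., n + L` (`endInv_eq_netInv_add`). Let `β` and `β⁻`
be the means of the net inventory and of its negative part, `e` the mean leftover and `ℓ` the mean
lost sales. Then `e = β + (L + 1) ℓ` and `ℓ ≤ β⁻ ≤ (L + 1) ℓ`. Hence the cost `h e + p ℓ = h β + (h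
(L + 1) + p) ℓ` is at most the backorder cost with penalty `p + L h` and at least that with penalty
`p / (L + 1)`. The averages exist by a mean ergodic theorem on a finite state space
(`cesaroTendsto_pow_apply`).

Constant orders: the leftover follows Lindley's recursion with increments `c - D`. Spitzer's
identity (`IsArrivalProcess.integral_lindley`), proved by cyclic rotation of the increments, gives
its mean after `n` cycles as the `n`-th partial sum of the series in `aTwo`. If the series
converges, conservation of units makes the mean lost sales converge to `T (1 - lam0) - c`, and
`aTwo` is the exact cost. If it diverges, the cost is `⊤` and the profit `⊥`.

Optimal parameters exist because large levels or quantities do no better than `0`. The bounds follow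
by comparing each profit-optimal parameter with the cost-optimal one. -/

namespace Replenishment

/-! ### Law of finitely many cycles: first-step analysis, shift and rotation invariance -/

section ArrivalLaw

variable {M T : ℕ}

/-- The law of the arrival in one period. -/
noncomputable def arrivalProb (lam : Fin M → ℝ) (o : Option (Fin M)) : ℝ := o.elim (lam0 lam) lam

/-- The law of the arrivals in one cycle. -/
noncomputable def cycleProb (lam : Fin M → ℝ) (d : CycleArrivals M T) : ℝ :=
  ∏ t, arrivalProb lam (d t)

theorem sum_arrivalProb (lam : Fin M → ℝ) : ∑ o, arrivalProb lam o = 1 := by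
  simp [Fintype.sum_option, arrivalProb, lam0]

theorem sum_cycleProb (lam : Fin M → ℝ) : ∑ d : CycleArrivals M T, cycleProb lam d = 1 := by
  unfold cycleProb
  rw [← Fintype.sum_pow, sum_arrivalProb, one_pow]

theorem arrivalProb_nonneg {lam : Fin M → ℝ} (hlam : ∀ j, 0 ≤ lam j) (hs : ∑ j, lam j ≤ 1)
    (o : Option (Fin M)) : 0 ≤ arrivalProb lam o := by
  cases o with
  | none => simpa [arrivalProb, lam0] using hs
  | some j => exact hlam j

theorem cycleProb_nonneg {lam : Fin M → ℝ} (hlam : ∀ j, 0 ≤ lam j) (hs : ∑ j, lam j ≤ 1)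
    (d : CycleArrivals M T) : 0 ≤ cycleProb lam d :=
  Finset.prod_nonneg fun _ _ => arrivalProb_nonneg hlam hs _

/-- Extend a finite path by cycles without arrivals. -/
def extendPath {n : ℕ} (x : Fin n → CycleArrivals M T) : ArrivalPath M T :=
  fun i => if h : i < n then x ⟨i, h⟩ else fun _ => none

/-- Put a cycle in front of a path. -/
def consPath (a : CycleArrivals M T) (H : ArrivalPath M T) : ArrivalPath M T
  | 0 => a
  | n + 1 => H n

/-- Drop the first cycle. -/
def tailPath (H : ArrivalPath M T) : ArrivalPath M T := fun n => H (n + 1)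

@[simp] theorem tailPath_consPath (a : CycleArrivals M T) (H : ArrivalPath M T) :
    tailPath (consPath a H) = H := rfl

theorem extendPath_cons {n : ℕ} (a : CycleArrivals M T) (x : Fin n → CycleArrivals M T) :
    extendPath (Fin.cons a x : Fin (n + 1) → CycleArrivals M T) = consPath a (extendPath x) := by
  funext i
  cases i with
  | zero => simp [extendPath, consPath]
  | succ i =>
    by_cases h : i < n
    · simp only [extendPath, consPath, h, Nat.succ_lt_succ_iff, dite_true]
      rfl
    · simp [extendPath, consPath, h]

variable {Ω : Type*} [MeasurableSpace Ω] {P : Measure Ω} [IsProbabilityMeasure P]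
  {lam : Fin M → ℝ} {X : Ω → ArrivalPath M T}

theorem IsArrivalProcess.real_period (hX : IsArrivalProcess P lam X) (hlam : ∀ j, 0 ≤ lam j)
    (n : ℕ) (t : Fin T) (o : Option (Fin M)) :
    P.real ((fun ω => X ω n t) ⁻¹' {o}) = arrivalProb lam o := by
  have hsome : ∀ j, P.real ((fun ω => X ω n t) ⁻¹' {some j}) = lam j := fun j => by
    have := hX.law n t j
    rw [measureReal_def]
    change (P {ω | X ω n t = some j}).toReal = _
    rw [this, ENNReal.toReal_ofReal (hlam j)]
  have hsum : ∑ o, P.real ((fun ω => X ω n t) ⁻¹' {o}) = 1 := by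
    rw [sum_measureReal_preimage_singleton _ fun o _ => hX.measurable n t trivial]
    simp
  cases o with
  | some j => exact hsome j
  | none =>
    rw [Fintype.sum_option] at hsum
    simp only [hsome] at hsum
    simp only [arrivalProb, lam0, Option.elim]
    linarith

theorem IsArrivalProcess.measurable_prefix (hX : IsArrivalProcess P lam X) (n : ℕ) :
    Measurable fun ω (i : Fin n) => X ω i :=
  measurable_pi_lambda _ fun i => measurable_pi_lambda _ fun t => hX.measurable i t

theorem IsArrivalProcess.real_prefix (hX : IsArrivalProcess P lam X) (hlam : ∀ j, 0 ≤ lam j)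
    (n : ℕ) (x : Fin n → CycleArrivals M T) :
    P.real ((fun ω (i : Fin n) => X ω i) ⁻¹' {x}) = ∏ i, cycleProb lam (x i) := by
  have hind := hX.indep.measure_inter_preimage_eq_mul (Finset.range n ×ˢ Finset.univ)
    (sets := fun i => {extendPath x i.1 i.2}) (fun _ _ => trivial)
  have hset : (fun ω (i : Fin n) => X ω i) ⁻¹' {x} =
      ⋂ i ∈ Finset.range n ×ˢ (Finset.univ : Finset (Fin T)),
        (fun ω => X ω i.1 i.2) ⁻¹' {extendPath x i.1 i.2} := by
    ext ω
    simp only [Set.mem_preimage, Set.mem_singleton_iff, Finset.mem_product, Finset.mem_range,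
      Finset.mem_univ, and_true, Set.mem_iInter, Prod.forall]
    constructor
    · intro h i t hi
      simp [extendPath, hi, ← h]
    · intro h
      funext i t
      simpa [extendPath] using h i t i.2
  rw [hset, measureReal_def, hind, ENNReal.toReal_prod, Finset.prod_product,
    Finset.prod_range]
  refine Finset.prod_congr rfl fun i _ => Finset.prod_congr rfl fun t _ => ?_
  have := hX.real_period hlam i t (extendPath x i t)
  rw [measureReal_def] at this
  rw [this]
  simp [extendPath]

/-- A function of the first `n` cycles factors through a finite type. This is what makes every such
function integrable and turns its expectation into a finite sum. -/
theorem comp_path_eq {F : ArrivalPath M T → ℝ} {n : ℕ} (hF : DependsOn F (Set.Iio n)) :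
    (fun ω => F (X ω)) = (fun x : Fin n → CycleArrivals M T => F (extendPath x)) ∘
      fun ω (i : Fin n) => X ω i := by
  funext ω
  refine hF fun i hi => ?_
  simp only [Set.mem_Iio] at hi
  simp [extendPath, hi]

theorem IsArrivalProcess.integrable (hX : IsArrivalProcess P lam X) {F : ArrivalPath M T → ℝ}
    {n : ℕ} (hF : DependsOn F (Set.Iio n)) : Integrable (fun ω => F (X ω)) P := by
  rw [comp_path_eq hF]
  have hm := hX.measurable_prefix n
  have : IsProbabilityMeasure (P.map fun ω (i : Fin n) => X ω i) :=
    Measure.isProbabilityMeasure_map hm.aemeasurable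
  exact (Integrable.of_finite).comp_measurable hm

theorem IsArrivalProcess.integral_eq_sum (hX : IsArrivalProcess P lam X) (hlam : ∀ j, 0 ≤ lam j)
    {F : ArrivalPath M T → ℝ} {n : ℕ} (hF : DependsOn F (Set.Iio n)) :
    ∫ ω, F (X ω) ∂P =
      ∑ x : Fin n → CycleArrivals M T, (∏ i, cycleProb lam (x i)) * F (extendPath x) := by
  have hm := hX.measurable_prefix n
  have : IsProbabilityMeasure (P.map fun ω (i : Fin n) => X ω i) :=
    Measure.isProbabilityMeasure_map hm.aemeasurable
  have h1 : ∫ ω, F (X ω) ∂P =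
      ∫ x, F (extendPath x) ∂(P.map fun ω (i : Fin n) => X ω i) := by
    rw [integral_map hm.aemeasurable (measurable_of_finite _).aestronglyMeasurable]
    exact congrArg (fun f => ∫ ω, f ω ∂P) (comp_path_eq hF)
  rw [h1, integral_fintype Integrable.of_finite]
  refine Finset.sum_congr rfl fun x _ => ?_
  rw [map_measureReal_apply hm (MeasurableSet.singleton x), hX.real_prefix hlam, smul_eq_mul]

theorem dependsOn_consPath {F : ArrivalPath M T → ℝ} {n : ℕ}
    (hF : DependsOn F (Set.Iio (n + 1))) (a : CycleArrivals M T) :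
    DependsOn (fun H => F (consPath a H)) (Set.Iio n) := by
  intro H H' h
  refine hF fun i hi => ?_
  cases i with
  | zero => rfl
  | succ i => exact h i (by simpa using hi)

theorem dependsOn_tailPath {F : ArrivalPath M T → ℝ} {n : ℕ} (hF : DependsOn F (Set.Iio n)) :
    DependsOn (fun H => F (tailPath H)) (Set.Iio (n + 1)) := by
  intro H H' h
  exact hF fun i hi => h (i + 1) (by simpa using hi)

/-- First-step decomposition of an expectation. -/
theorem IsArrivalProcess.integral_first_step (hX : IsArrivalProcess P lam X)
    (hlam : ∀ j, 0 ≤ lam j) {F : ArrivalPath M T → ℝ} {n : ℕ}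
    (hF : DependsOn F (Set.Iio (n + 1))) :
    ∫ ω, F (X ω) ∂P = ∑ a, cycleProb lam a * ∫ ω, F (consPath a (X ω)) ∂P := by
  rw [hX.integral_eq_sum hlam hF]
  simp_rw [fun a => hX.integral_eq_sum hlam (dependsOn_consPath hF a)]
  rw [← (Fin.consEquiv fun _ => CycleArrivals M T).sum_comp, Fintype.sum_prod_type]
  refine Finset.sum_congr rfl fun a _ => ?_
  rw [Finset.mul_sum]
  refine Finset.sum_congr rfl fun x _ => ?_
  rw [Fin.prod_univ_succ, ← mul_assoc]
  simp [Fin.consEquiv, extendPath_cons]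

theorem IsArrivalProcess.integral_tail (hX : IsArrivalProcess P lam X)
    (hlam : ∀ j, 0 ≤ lam j) {F : ArrivalPath M T → ℝ} {n : ℕ} (hF : DependsOn F (Set.Iio n)) :
    ∫ ω, F (tailPath (X ω)) ∂P = ∫ ω, F (X ω) ∂P := by
  rw [hX.integral_first_step hlam (dependsOn_tailPath hF)]
  simp [← Finset.sum_mul, sum_cycleProb]

theorem IsArrivalProcess.integral_shift (hX : IsArrivalProcess P lam X)
    (hlam : ∀ j, 0 ≤ lam j) {F : ArrivalPath M T → ℝ} {n : ℕ} (hF : DependsOn F (Set.Iio n))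
    (m : ℕ) : ∫ ω, F (fun i => X ω (i + m)) ∂P = ∫ ω, F (X ω) ∂P := by
  induction m with
  | zero => rfl
  | succ m ih =>
    rw [← ih]
    have hG : DependsOn (fun H : ArrivalPath M T => F (fun i => H (i + m))) (Set.Iio (n + m)) :=
      fun H H' h => hF fun i hi => h (i + m) (by simpa using hi)
    rw [← hX.integral_tail hlam hG]
    rfl

/-- The law of the first `n` cycles is invariant under cyclic rotation. -/
theorem IsArrivalProcess.integral_rotate (hX : IsArrivalProcess P lam X)
    (hlam : ∀ j, 0 ≤ lam j) {F : ArrivalPath M T → ℝ} {n : ℕ} (hn : 0 < n)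
    (hF : DependsOn F (Set.Iio n)) (m : ℕ) :
    ∫ ω, F (fun i => X ω ((i + m) % n)) ∂P = ∫ ω, F (X ω) ∂P := by
  have hG : DependsOn (fun H : ArrivalPath M T => F (fun i => H ((i + m) % n))) (Set.Iio n) :=
    fun H H' h => hF fun i _ => h _ (Nat.mod_lt _ hn)
  rw [hX.integral_eq_sum hlam hF, hX.integral_eq_sum hlam hG]
  have : NeZero n := ⟨hn.ne'⟩
  -- Rotation is addition of `m` in `Fin n`; reindexing the finite sum by it leaves the product
  -- weights unchanged.
  let e : Fin n ≃ Fin n := Equiv.addRight (Fin.ofNat n m)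
  rw [← (Equiv.arrowCongr e (Equiv.refl _)).sum_comp]
  refine Finset.sum_congr rfl fun x _ => ?_
  congr 1
  · exact e.symm.prod_comp fun i => cycleProb lam (x i)
  · refine hF fun i hi => ?_
    simp only [Set.mem_Iio] at hi
    simp only [extendPath, Nat.mod_lt _ hn, hi, dite_true, Equiv.arrowCongr_apply,
      Equiv.coe_refl, Function.comp_apply, id]
    congr 1
    rw [Equiv.symm_apply_eq]
    ext
    simp [e, Fin.val_add]

end ArrivalLaw

/-! ### Binomial law of the total demand -/

section DemandLaw

variable {M T : ℕ}

/-- Averaging over one period: with probability `1 - l0` the count increases by one. -/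
noncomputable def countStep (l0 : ℝ) : Module.End ℝ (ℕ → ℝ) :=
  (1 - l0) • LinearMap.funLeft ℝ ℝ Nat.succ + l0 • 1

theorem countStep_apply (l0 : ℝ) (f : ℕ → ℝ) (k : ℕ) :
    countStep l0 f k = (1 - l0) * f (k + 1) + l0 * f k := by
  simp [countStep, LinearMap.funLeft_apply]

theorem funLeft_succ_pow_apply (m : ℕ) (f : ℕ → ℝ) (k : ℕ) :
    ((LinearMap.funLeft ℝ ℝ Nat.succ ^ m : Module.End ℝ (ℕ → ℝ)) f) k = f (k + m) := by
  induction m generalizing k f with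
  | zero => simp
  | succ m ih =>
    rw [pow_succ, Module.End.mul_apply, ih, LinearMap.funLeft_apply]
    rfl

/-- `countStep` is a combination of the shift and the identity, which commute, so the binomial
theorem for operators yields the binomial distribution. -/
theorem countStep_pow_apply (l0 : ℝ) (m : ℕ) (f : ℕ → ℝ) (j : ℕ) :
    ((countStep l0 ^ m) f) j =
      ∑ k ∈ Finset.range (m + 1), (m.choose k : ℝ) * (1 - l0) ^ k * l0 ^ (m - k) * f (j + k) := by
  unfold countStep
  rw [Commute.add_pow (by
    refine Commute.smul_right (Commute.smul_left (Commute.one_right _) _) _)]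
  rw [LinearMap.sum_apply, Finset.sum_apply]
  refine Finset.sum_congr rfl fun k _ => ?_
  rw [smul_pow, smul_pow, one_pow, smul_mul_smul_comm, mul_one, ← nsmul_eq_mul', LinearMap.smul_apply,
    Pi.smul_apply, LinearMap.smul_apply, Pi.smul_apply, funLeft_succ_pow_apply]
  simp
  ring

/-- Splitting off one period, all customer types raise the count equally, and their probabilities
add up to `1 - lam0 lam`. -/
theorem sum_prod_arrivalProb_count (lam : Fin M → ℝ) (f : ℕ → ℝ) (k : ℕ) :
    ∑ d : CycleArrivals M T, cycleProb lam d * f (k + demand d) =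
      ((countStep (lam0 lam) ^ T) f) k := by
  induction T generalizing k with
  | zero =>
    simp [cycleProb, demand]
  | succ T ih =>
    rw [← (Fin.consEquiv fun _ => Option (Fin M)).sum_comp, Fintype.sum_prod_type, pow_succ',
      Module.End.mul_apply, countStep_apply, ← ih, ← ih]
    have key : ∀ (o : Option (Fin M)) (d : CycleArrivals M T),
        cycleProb lam (Fin.cons o d : CycleArrivals M (T + 1)) *
            f (k + demand (Fin.cons o d : CycleArrivals M (T + 1))) =
          arrivalProb lam o * (cycleProb lam d *
            f (k + (if o.isSome then 1 else 0) + demand d)) := by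
      intro o d
      have h1 : demand (Fin.cons o d : CycleArrivals M (T + 1)) =
          (if o.isSome then 1 else 0) + demand d := by
        simp only [demand, Finset.card_filter, Fin.sum_univ_succ, Fin.cons_zero, Fin.cons_succ]
      rw [h1]
      unfold cycleProb
      rw [Fin.prod_univ_succ]
      simp [mul_assoc, add_assoc]
    have hcons : ∀ p : Option (Fin M) × CycleArrivals M T,
        (Fin.consEquiv fun _ => Option (Fin M)) p = Fin.cons p.1 p.2 := fun _ => rfl
    simp only [hcons, key, ← Finset.mul_sum, Fintype.sum_option]
    simp [arrivalProb, lam0, ← Finset.sum_mul]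
    ring

theorem sum_cycleProb_demand (lam : Fin M → ℝ) :
    ∑ d : CycleArrivals M T, cycleProb lam d * (demand d : ℝ) = T * (1 - lam0 lam) := by
  have h := sum_prod_arrivalProb_count (T := T) lam (fun k => (k : ℝ)) 0
  simp only [zero_add] at h
  rw [h]
  have : ∀ (m k : ℕ), ((countStep (lam0 lam) ^ m) fun k => (k : ℝ)) k =
      k + m * (1 - lam0 lam) := by
    intro m
    induction m with
    | zero => simp
    | succ m ih =>
      intro k
      rw [pow_succ', Module.End.mul_apply, countStep_apply, ih, ih]
      push_cast
      ring
  simpa using this T 0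

variable {Ω : Type*} [MeasurableSpace Ω] {P : Measure Ω} [IsProbabilityMeasure P]
  {lam : Fin M → ℝ} {X : Ω → ArrivalPath M T}

theorem dependsOn_sum_demand (n : ℕ) (φ : ℕ → ℝ) :
    DependsOn (fun H : ArrivalPath M T => φ (∑ i ∈ Finset.range n, demand (H i))) (Set.Iio n) := by
  intro H H' h
  simp only
  rw [Finset.sum_congr rfl fun i hi => by rw [h i (by simpa using hi)]]

/-- The total demand over `n` cycles is binomial. -/
theorem IsArrivalProcess.integral_demand (hX : IsArrivalProcess P lam X)
    (hlam : ∀ j, 0 ≤ lam j) (n : ℕ) (φ : ℕ → ℝ) :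
    ∫ ω, φ (∑ i ∈ Finset.range n, demand (X ω i)) ∂P =
      ∑ k ∈ Finset.range (n * T + 1), demandProb T (lam0 lam) n k * φ k := by
  have key : ∀ φ : ℕ → ℝ, ∫ ω, φ (∑ i ∈ Finset.range n, demand (X ω i)) ∂P =
      ((countStep (lam0 lam) ^ (n * T)) φ) 0 := by
    induction n with
    | zero => simp
    | succ n ih =>
      intro φ
      rw [hX.integral_first_step hlam (dependsOn_sum_demand (n + 1) φ)]
      simp only [Finset.sum_range_succ', consPath]
      have : ∀ a : CycleArrivals M T,
          ∫ ω, φ (∑ i ∈ Finset.range n, demand (X ω i) + demand a) ∂P =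
            ((countStep (lam0 lam) ^ (n * T)) φ) (0 + demand a) := fun a => by
        rw [ih fun k => φ (k + demand a), countStep_pow_apply, countStep_pow_apply]
        refine Finset.sum_congr rfl fun k _ => ?_
        simp [add_comm]
      simp only [this]
      rw [sum_prod_arrivalProb_count, ← Module.End.mul_apply, ← pow_add,
        show T + n * T = (n + 1) * T by ring]
  rw [key, countStep_pow_apply]
  simp [demandProb]

end DemandLaw

/-! ### Cesàro limits -/

section Cesaro

/-- The averages of the first `N` terms of `a` tend to `v`. -/
def CesaroTendsto (a : ℕ → ℝ) (v : ℝ) : Prop :=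
  Tendsto (fun N : ℕ => (1 / (N : ℝ)) * ∑ n ∈ Finset.range N, a n) atTop (𝓝 v)

variable {a b : ℕ → ℝ} {v w : ℝ}

theorem CesaroTendsto.of_tendsto (h : Tendsto a atTop (𝓝 v)) : CesaroTendsto a v := by
  simpa [CesaroTendsto] using h.cesaro

theorem CesaroTendsto.const (v : ℝ) : CesaroTendsto (fun _ => v) v :=
  .of_tendsto tendsto_const_nhds

theorem CesaroTendsto.add (ha : CesaroTendsto a v) (hb : CesaroTendsto b w) :
    CesaroTendsto (fun n => a n + b n) (v + w) := by
  simpa [CesaroTendsto, Finset.sum_add_distrib, mul_add] using Tendsto.add ha hb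

theorem CesaroTendsto.const_mul (c : ℝ) (ha : CesaroTendsto a v) :
    CesaroTendsto (fun n => c * a n) (c * v) := by
  have := Tendsto.const_mul c ha
  simpa only [CesaroTendsto, ← Finset.mul_sum, mul_left_comm] using this

theorem CesaroTendsto.sum {ι : Type*} (s : Finset ι) {f : ι → ℕ → ℝ} {v : ι → ℝ}
    (h : ∀ i ∈ s, CesaroTendsto (f i) (v i)) :
    CesaroTendsto (fun n => ∑ i ∈ s, f i n) (∑ i ∈ s, v i) := by
  classical
  induction s using Finset.induction_on with
  | empty => simpa using CesaroTendsto.const 0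
  | insert i s hi ih =>
    simp only [Finset.sum_insert hi]
    exact (h i (by simp)).add (ih fun j hj => h j (by simp [hj]))

theorem CesaroTendsto.le (ha : CesaroTendsto a v) (hb : CesaroTendsto b w)
    (h : ∀ n, a n ≤ b n) : v ≤ w :=
  le_of_tendsto_of_tendsto' ha hb fun N =>
    mul_le_mul_of_nonneg_left (Finset.sum_le_sum fun n _ => h n) (by positivity)

theorem CesaroTendsto.unique (ha : CesaroTendsto a v) (hb : CesaroTendsto a w) : v = w :=
  tendsto_nhds_unique ha hb

theorem tendsto_one_div_mul_of_bounded {B : ℝ} (h : ∀ n, |a n| ≤ B) :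
    Tendsto (fun N : ℕ => (1 / (N : ℝ)) * a N) atTop (𝓝 0) := by
  have h0 : Tendsto (fun N : ℕ => (1 / (N : ℝ)) * B) atTop (𝓝 0) := by
    simpa using tendsto_one_div_atTop_nhds_zero_nat.mul_const B
  refine squeeze_zero_norm (fun N => ?_) h0
  rw [norm_mul, Real.norm_of_nonneg (by positivity)]
  exact mul_le_mul_of_nonneg_left (h N) (by positivity)

theorem CesaroTendsto.tail {B : ℝ} (h : ∀ n, |a n| ≤ B) (ha : CesaroTendsto a v) :
    CesaroTendsto (fun n => a (n + 1)) v := by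
  have h1 : Tendsto (fun N : ℕ => (1 / (N : ℝ)) * (a N - a 0)) atTop (𝓝 0) :=
    tendsto_one_div_mul_of_bounded (B := B + B) fun n =>
      (abs_sub _ _).trans (add_le_add (h n) (h 0))
  have h2 := Tendsto.add ha h1
  rw [add_zero] at h2
  refine h2.congr fun N => ?_
  rw [← mul_add]
  congr 1
  have := Finset.sum_range_succ' a N
  rw [Finset.sum_range_succ] at this
  linarith

theorem CesaroTendsto.shift {B : ℝ} (h : ∀ n, |a n| ≤ B) (ha : CesaroTendsto a v) (m : ℕ) :
    CesaroTendsto (fun n => a (n + m)) v := by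
  induction m with
  | zero => exact ha
  | succ m ih =>
    have := CesaroTendsto.tail (a := fun n => a (n + m)) (fun n => h (n + m)) ih
    simpa only [← add_assoc, add_right_comm _ 1 m] using this

/-- Once the terms exceed `2 C` from index `m` on, more than half of the first `N ≥ 2 m + 1` terms
do, and the others are nonnegative. -/
theorem tendsto_average_atTop_of_monotone (hmono : Monotone a) (h0 : 0 ≤ a 0)
    (h : Tendsto a atTop atTop) :
    Tendsto (fun N : ℕ => (1 / (N : ℝ)) * ∑ n ∈ Finset.range N, a n) atTop atTop := by
  refine tendsto_atTop.2 fun C => ?_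
  obtain ⟨m, hm⟩ := (tendsto_atTop.1 h (2 * max C 0)).exists
  filter_upwards [eventually_ge_atTop (2 * m + 1)] with N hN
  have hNpos : (0 : ℝ) < N := by exact_mod_cast (by omega : 0 < N)
  rw [one_div, ← div_eq_inv_mul, le_div_iff₀ hNpos]
  have hnn : ∀ n, 0 ≤ a n := fun n => h0.trans (hmono (Nat.zero_le n))
  have h1 : ∑ n ∈ Finset.Ico m N, a n ≤ ∑ n ∈ Finset.range N, a n :=
    Finset.sum_le_sum_of_subset_of_nonneg (fun n hn => by simp at hn ⊢; omega) fun n _ _ => hnn n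
  have h2 : ∑ _n ∈ Finset.Ico m N, 2 * max C 0 ≤ ∑ n ∈ Finset.Ico m N, a n :=
    Finset.sum_le_sum fun n hn => hm.trans (hmono (Finset.mem_Ico.1 hn).1)
  rw [Finset.sum_const, Nat.card_Ico, nsmul_eq_mul, Nat.cast_sub (by omega)] at h2
  have h3 : (2 * m + 1 : ℝ) ≤ N := by exact_mod_cast hN
  have h4 : C * N ≤ max C 0 * N := mul_le_mul_of_nonneg_right (le_max_left _ _) hNpos.le
  nlinarith [le_max_right C 0]

end Cesaro

/-! ### Mean ergodic theorem in finite dimension -/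

section MeanErgodic

variable {σ : Type*} [Finite σ]

/-- For a sup-norm contraction the space is the direct sum of `ker (K - 1)` and `range (K - 1)`. On
the kernel the averages are constant; on the range they telescope to a bounded difference divided by
`N`. No irreducibility or aperiodicity is needed. -/
theorem cesaroTendsto_pow_apply (K : Module.End ℝ (σ → ℝ))
    (hK : ∀ (f : σ → ℝ) (B : ℝ), (∀ s, |f s| ≤ B) → ∀ s, |K f s| ≤ B) (f : σ → ℝ) (s : σ) :
    ∃ v, CesaroTendsto (fun n => (K ^ n) f s) v := by
  have hpow : ∀ (g : σ → ℝ) (B : ℝ), (∀ s, |g s| ≤ B) → ∀ n s, |(K ^ n) g s| ≤ B := by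
    intro g B hg n
    induction n with
    | zero => simpa using hg
    | succ n ih =>
      intro s
      rw [pow_succ', Module.End.mul_apply]
      exact hK _ B ih s
  have hbdd : ∀ g : σ → ℝ, ∃ B, ∀ s, |g s| ≤ B := fun g =>
    ⟨_, fun s => le_ciSup (Set.finite_range fun s => |g s|).bddAbove s⟩
  have htel : ∀ (g : σ → ℝ) (N : ℕ) (s : σ),
      ∑ n ∈ Finset.range N, (K ^ n) ((K - 1) g) s = (K ^ N) g s - g s := by
    intro g N s
    have : ∀ n, (K ^ n) ((K - 1) g) s = (K ^ (n + 1)) g s - (K ^ n) g s := fun n => by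
      rw [pow_succ, Module.End.mul_apply, LinearMap.sub_apply, map_sub]
      rfl
    simp only [this]
    rw [Finset.sum_range_sub fun n => (K ^ n) g s]
    simp
  have hfix : ∀ y : σ → ℝ, K y = y → ∀ n, (K ^ n) y = y := by
    intro y hy n
    induction n with
    | zero => simp
    | succ n ih => rw [pow_succ, Module.End.mul_apply, hy, ih]
  have hlim : ∀ (g : σ → ℝ) (s : σ), CesaroTendsto (fun n => (K ^ n) ((K - 1) g) s) 0 := by
    intro g s
    obtain ⟨B, hB⟩ := hbdd g
    refine (tendsto_one_div_mul_of_bounded (a := fun N => (K ^ N) g s - g s) (B := B + B)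
      fun n => (abs_sub _ _).trans (add_le_add (hpow g B hB n s) (hB s))).congr fun N => ?_
    rw [htel]
  -- A fixed vector in the range has averages equal to itself and tending to `0`, so it vanishes;
  -- rank-nullity then makes the two subspaces span.
  have hdisj : Disjoint (LinearMap.ker (K - 1)) (LinearMap.range (K - 1)) := by
    rw [Submodule.disjoint_def]
    rintro x hx ⟨g, rfl⟩
    have hx' : K ((K - 1) g) = (K - 1) g := by
      rw [LinearMap.mem_ker, LinearMap.sub_apply, sub_eq_zero] at hx
      exact hx
    funext s
    refine CesaroTendsto.unique (a := fun _ => (K - 1) g s) (.const _) ?_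
    have := hlim g s
    simp only [hfix _ hx'] at this
    exact this
  have htop : LinearMap.ker (K - 1) ⊔ LinearMap.range (K - 1) = ⊤ := by
    refine Submodule.eq_top_of_disjoint _ _ ?_ hdisj
    rw [add_comm, LinearMap.finrank_range_add_finrank_ker]
  obtain ⟨y, hy, z, ⟨g, rfl⟩, rfl⟩ :=
    Submodule.mem_sup.1 (htop ▸ Submodule.mem_top : f ∈ _)
  have hy' : K y = y := by
    rw [LinearMap.mem_ker, LinearMap.sub_apply, sub_eq_zero] at hy
    exact hy
  refine ⟨y s + 0, ?_⟩
  simp only [map_add, Pi.add_apply, hfix y hy']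
  exact (CesaroTendsto.const (y s)).add (hlim g s)

end MeanErgodic

/-! ### Markov chains driven by i.i.d. inputs -/

section Chain

variable {σ α : Type*} [Fintype α]

/-- State after `n` steps of the recursion `φ` driven by the inputs `H`. -/
def chainState (φ : σ → α → σ) (s : σ) (H : ℕ → α) : ℕ → σ
  | 0 => s
  | n + 1 => φ (chainState φ s H n) (H n)

/-- Expected value of `f` at step `n` of the Markov chain with i.i.d. inputs of law `μ`. -/
def chainExp (μ : α → ℝ) (φ : σ → α → σ) (f : σ → α → ℝ) : ℕ → σ → ℝ
  | 0, s => ∑ a, μ a * f s a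
  | n + 1, s => ∑ a, μ a * chainExp μ φ f n (φ s a)

/-- Lumping of states: it allows passing from an infinite state type to a finite set of
representatives. -/
theorem chainExp_comp {σ' : Type*} {μ : α → ℝ} {φ : σ → α → σ} {φ' : σ' → α → σ'}
    (c : σ → σ') (hφ : ∀ s a, c (φ s a) = φ' (c s) a) (f' : σ' → α → ℝ) (n : ℕ) (s : σ) :
    chainExp μ φ (fun s a => f' (c s) a) n s = chainExp μ φ' f' n (c s) := by
  induction n generalizing s with
  | zero => rfl
  | succ n ih => simp only [chainExp, ih, hφ]

/-- On a finite invariant set the transition operator averages values, hence is a sup-norm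
contraction to which the mean ergodic theorem applies. -/
theorem exists_cesaroTendsto_chainExp {μ : α → ℝ} (hμ : ∀ a, 0 ≤ μ a) (hμ1 : ∑ a, μ a = 1)
    (φ : σ → α → σ) (f : σ → α → ℝ) {F : Set σ} (hF : F.Finite)
    (hφ : ∀ s ∈ F, ∀ a, φ s a ∈ F) {s : σ} (hs : s ∈ F) :
    ∃ v, CesaroTendsto (fun n => chainExp μ φ f n s) v := by
  have := hF.to_subtype
  let K : Module.End ℝ (F → ℝ) :=
    { toFun := fun g s => ∑ a, μ a * g ⟨φ s a, hφ s s.2 a⟩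
      map_add' := fun g g' => by
        funext s
        simp [mul_add, Finset.sum_add_distrib]
      map_smul' := fun c g => by
        funext s
        simp [Finset.mul_sum, mul_left_comm] }
  have hK : ∀ (g : F → ℝ) (B : ℝ), (∀ s, |g s| ≤ B) → ∀ s, |K g s| ≤ B := by
    intro g B hg s
    calc |∑ a, μ a * g ⟨φ s a, hφ s s.2 a⟩| ≤ ∑ a, |μ a * g ⟨φ s a, hφ s s.2 a⟩| :=
          Finset.abs_sum_le_sum_abs _ _
      _ ≤ ∑ a, μ a * B := Finset.sum_le_sum fun a _ => by
          rw [abs_mul, abs_of_nonneg (hμ a)]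
          exact mul_le_mul_of_nonneg_left (hg _) (hμ a)
      _ = B := by rw [← Finset.sum_mul, hμ1, one_mul]
  have hpow : ∀ (n : ℕ) (s : F),
      (K ^ n) (fun s => ∑ a, μ a * f s a) s = chainExp μ φ f n s := by
    intro n
    induction n with
    | zero => intro s; rfl
    | succ n ih =>
      intro s
      rw [pow_succ', Module.End.mul_apply]
      simp only [chainExp]
      exact Finset.sum_congr rfl fun a _ => by rw [ih]
  obtain ⟨v, hv⟩ := cesaroTendsto_pow_apply K hK (fun s => ∑ a, μ a * f s a) ⟨s, hs⟩
  exact ⟨v, by simpa only [hpow] using hv⟩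

theorem chainExp_mono {μ : α → ℝ} (hμ : ∀ a, 0 ≤ μ a) {φ : σ → α → σ} {f : σ → α → ℝ}
    {R : σ → σ → Prop} (hφ : ∀ s s' a, R s s' → R (φ s a) (φ s' a))
    (hf : ∀ s s' a, R s s' → f s a ≤ f s' a) (n : ℕ) {s s' : σ} (h : R s s') :
    chainExp μ φ f n s ≤ chainExp μ φ f n s' := by
  induction n generalizing s s' with
  | zero => exact Finset.sum_le_sum fun a _ => mul_le_mul_of_nonneg_left (hf _ _ a h) (hμ a)
  | succ n ih =>
    exact Finset.sum_le_sum fun a _ => mul_le_mul_of_nonneg_left (ih (hφ _ _ a h)) (hμ a)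

/-- Started in a least state, a monotone chain has nondecreasing expectations. -/
theorem chainExp_monotone {μ : α → ℝ} (hμ : ∀ a, 0 ≤ μ a) (hμ1 : ∑ a, μ a = 1) {φ : σ → α → σ}
    {f : σ → α → ℝ} {R : σ → σ → Prop} (hφ : ∀ s s' a, R s s' → R (φ s a) (φ s' a))
    (hf : ∀ s s' a, R s s' → f s a ≤ f s' a) {s : σ} (hs : ∀ a, R s (φ s a)) :
    Monotone fun n => chainExp μ φ f n s := by
  refine monotone_nat_of_le_succ fun n => ?_
  calc chainExp μ φ f n s = ∑ a, μ a * chainExp μ φ f n s := by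
        rw [← Finset.sum_mul, hμ1, one_mul]
    _ ≤ chainExp μ φ f (n + 1) s := Finset.sum_le_sum fun a _ =>
        mul_le_mul_of_nonneg_left (chainExp_mono hμ hφ hf n (hs a)) (hμ a)

end Chain

/-! ### Expectations along the arrival process as chain expectations -/

section ChainLaw

variable {M T : ℕ} {σ : Type*} {φ : σ → CycleArrivals M T → σ}

theorem chainState_congr {s : σ} {H H' : ArrivalPath M T} {n : ℕ} (h : ∀ i < n, H i = H' i) :
    chainState φ s H n = chainState φ s H' n := by
  induction n with
  | zero => rfl
  | succ n ih =>
    rw [chainState, chainState, ih fun i hi => h i (by omega), h n (by omega)]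

theorem chainState_consPath (s : σ) (a : CycleArrivals M T) (H : ArrivalPath M T) (n : ℕ) :
    chainState φ s (consPath a H) (n + 1) = chainState φ (φ s a) H n := by
  induction n with
  | zero => rfl
  | succ n ih =>
    rw [chainState, ih]
    rfl

theorem dependsOn_chainState (f : σ → CycleArrivals M T → ℝ) (s : σ) (n : ℕ) :
    DependsOn (fun H : ArrivalPath M T => f (chainState φ s H n) (H n)) (Set.Iio (n + 1)) := by
  intro H H' h
  simp only
  rw [chainState_congr fun i hi => h i (by simp; omega), h n (by simp)]

variable {Ω : Type*} [MeasurableSpace Ω] {P : Measure Ω} [IsProbabilityMeasure P]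
  {lam : Fin M → ℝ} {X : Ω → ArrivalPath M T}

theorem IsArrivalProcess.integral_chainState (hX : IsArrivalProcess P lam X)
    (hlam : ∀ j, 0 ≤ lam j) (f : σ → CycleArrivals M T → ℝ) (n : ℕ) (s : σ) :
    ∫ ω, f (chainState φ s (X ω) n) (X ω n) ∂P = chainExp (cycleProb lam) φ f n s := by
  induction n generalizing s with
  | zero =>
    rw [hX.integral_first_step hlam (dependsOn_chainState f s 0)]
    simp [chainState, chainExp, consPath]
  | succ n ih =>
    rw [hX.integral_first_step hlam (dependsOn_chainState f s (n + 1))]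
    simp only [chainState_consPath, consPath, ih, chainExp]

/-- Expected averages in terms of the expectations per cycle. -/
theorem IsArrivalProcess.hasLongRunAverage_iff (hX : IsArrivalProcess P lam X)
    {f : ArrivalPath M T → ℕ → ℝ}
    (hf : ∀ n, DependsOn (fun H => f H n) (Set.Iio (n + 1))) (v : EReal) :
    HasLongRunAverage P X f v ↔ Tendsto (fun N : ℕ =>
      (((1 / (N : ℝ)) * ∑ n ∈ Finset.range N, ∫ ω, f (X ω) n ∂P : ℝ) : EReal)) atTop (𝓝 v) := by
  unfold HasLongRunAverage
  have : ∀ N, ∫ ω, ∑ n ∈ Finset.range N, f (X ω) n ∂P =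
      ∑ n ∈ Finset.range N, ∫ ω, f (X ω) n ∂P := fun N =>
    integral_finsetSum _ fun n _ => hX.integrable (hf n)
  simp only [this]

theorem IsArrivalProcess.hasLongRunAverage_coe_iff (hX : IsArrivalProcess P lam X)
    {f : ArrivalPath M T → ℕ → ℝ}
    (hf : ∀ n, DependsOn (fun H => f H n) (Set.Iio (n + 1))) (v : ℝ) :
    HasLongRunAverage P X f v ↔ CesaroTendsto (fun n => ∫ ω, f (X ω) n ∂P) v := by
  rw [hX.hasLongRunAverage_iff hf, EReal.tendsto_coe]
  rfl

end ChainLaw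

/-! ### One cycle of myopic offline fulfillment -/

section CycleLemmas

variable {M T : ℕ}

/-- The periods with an arrival. -/
def arrivals (d : CycleArrivals M T) : Finset (Fin T) :=
  Finset.univ.filter fun t => (d t).isSome

theorem card_arrivals (d : CycleArrivals M T) : (arrivals d).card = demand d := rfl

theorem demand_le (d : CycleArrivals M T) : demand d ≤ T :=
  (Finset.card_le_univ _).trans (by simp)

/-- By transitivity of the service order, everyone ahead of `s` is ahead of `t`, and `s` is one
more. So `ahead` ranks the arrivals without ties. -/
theorem ahead_lt_ahead {d : CycleArrivals M T} {s t : Fin T} {i j : Fin M} (hs : d s = some i)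
    (ht : d t = some j) (h : j < i ∨ (i = j ∧ s < t)) : ahead d s < ahead d t := by
  refine Finset.card_lt_card (Finset.ssubset_iff_of_subset ?_ |>.2 ⟨s, ?_, ?_⟩)
  · intro u hu
    simp only [Finset.mem_filter, Finset.mem_univ, true_and, Option.mem_def, hs, ht,
      Option.some.injEq, exists_eq_left'] at hu ⊢
    obtain ⟨k, hk, hu⟩ := hu
    refine ⟨k, hk, ?_⟩
    rcases h with h | ⟨rfl, h⟩ <;> rcases hu with hu | ⟨rfl, hu⟩
    · exact .inl (h.trans hu)
    · exact .inl h
    · exact .inl hu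
    · exact .inr ⟨rfl, hu.trans h⟩
  · simpa [hs, ht] using h
  · simp [hs]

theorem ahead_lt_demand {d : CycleArrivals M T} {t : Fin T} (ht : t ∈ arrivals d) :
    ahead d t < demand d := by
  refine Finset.card_lt_card (Finset.ssubset_iff_of_subset ?_ |>.2 ⟨t, ht, ?_⟩)
  · intro u hu
    simp only [Finset.mem_filter, Finset.mem_univ, true_and, Option.mem_def] at hu ⊢
    obtain ⟨k, hk, -⟩ := hu
    simp [hk]
  · cases h : d t <;> simp [h]

theorem injOn_ahead (d : CycleArrivals M T) : Set.InjOn (ahead d) (arrivals d) := by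
  intro s hs t ht h
  simp only [arrivals, Finset.coe_filter, Finset.mem_univ, true_and, Set.mem_ofPred_eq,
    Option.isSome_iff_exists] at hs ht
  obtain ⟨i, hi⟩ := hs
  obtain ⟨j, hj⟩ := ht
  by_contra hne
  rcases lt_trichotomy i j with hij | rfl | hij
  · exact (ahead_lt_ahead hj hi (.inl hij)).ne' h
  · rcases lt_or_gt_of_ne hne with hst | hst
    · exact (ahead_lt_ahead hi hj (.inr ⟨rfl, hst⟩)).ne h
    · exact (ahead_lt_ahead hj hi (.inr ⟨rfl, hst⟩)).ne' h
  · exact (ahead_lt_ahead hi hj (.inl hij)).ne h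

theorem image_ahead (d : CycleArrivals M T) :
    (arrivals d).image (ahead d) = Finset.range (demand d) := by
  refine Finset.eq_of_subset_of_card_le (fun k hk => ?_) ?_
  · obtain ⟨t, ht, rfl⟩ := Finset.mem_image.1 hk
    exact Finset.mem_range.2 (ahead_lt_demand ht)
  · rw [Finset.card_image_of_injOn (injOn_ahead d), Finset.card_range, card_arrivals]

theorem accepted_subset (I : ℤ) (d : CycleArrivals M T) : accepted I d ⊆ arrivals d := by
  intro t
  simp only [accepted, arrivals, Finset.mem_filter]
  tauto

theorem accepted_mono {I I' : ℤ} (h : I ≤ I') (d : CycleArrivals M T) :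
    accepted I d ⊆ accepted I' d := by
  intro t
  simp only [accepted, Finset.mem_filter]
  exact fun ⟨h1, h2, h3⟩ => ⟨h1, h2, h3.trans_le h⟩

/-- The ranks of the arrivals are exactly `0, ..., demand d - 1`, and accepted customers are those
of rank below `I`. -/
theorem sold_eq_min {I : ℤ} (hI : 0 ≤ I) (d : CycleArrivals M T) :
    sold I d = min I (demand d) := by
  lift I to ℕ using hI
  have himg : (accepted I d).image (ahead d) = Finset.range (min I (demand d)) := by
    ext k
    have hk : k < demand d ↔ k ∈ (arrivals d).image (ahead d) := by
      rw [image_ahead, Finset.mem_range]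
    rw [Finset.mem_range, lt_min_iff, hk]
    simp only [accepted, arrivals, Finset.mem_image, Finset.mem_filter, Finset.mem_univ,
      true_and, Nat.cast_lt]
    constructor
    · rintro ⟨t, ⟨h1, h2⟩, rfl⟩
      exact ⟨h2, t, h1, rfl⟩
    · rintro ⟨h2, t, h1, rfl⟩
      exact ⟨t, ⟨h1, h2⟩, rfl⟩
  have hcard := Finset.card_image_of_injOn ((injOn_ahead d).mono
    (Finset.coe_subset.2 (accepted_subset (I : ℤ) d)))
  rw [himg, Finset.card_range] at hcard
  rw [sold, ← hcard]
  push_cast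
  rfl

theorem endInv_eq_max {I : ℤ} (hI : 0 ≤ I) (d : CycleArrivals M T) :
    endInv I d = max (I - demand d) 0 := by
  rw [endInv, sold_eq_min hI]
  omega

theorem endInv_nonneg {I : ℤ} (hI : 0 ≤ I) (d : CycleArrivals M T) : 0 ≤ endInv I d := by
  rw [endInv_eq_max hI]
  exact le_max_right _ _

theorem sold_le_demand (I : ℤ) (d : CycleArrivals M T) : sold I d ≤ demand d := by
  have := Finset.card_le_card (accepted_subset I d)
  rw [card_arrivals] at this
  exact Int.ofNat_le.2 this

/-- Reward collected in a cycle. -/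
def acceptedReward (r : Fin M → ℝ) (I : ℤ) (d : CycleArrivals M T) : ℝ :=
  ∑ t ∈ accepted I d, (d t).elim 0 r

/-- Reward of all arrivals of a cycle. -/
def totalReward (r : Fin M → ℝ) (d : CycleArrivals M T) : ℝ :=
  ∑ t ∈ arrivals d, (d t).elim 0 r

variable {r : Fin M → ℝ}

theorem elim_nonneg (hr : ∀ j, 0 < r j) (o : Option (Fin M)) : 0 ≤ o.elim 0 r := by
  cases o with
  | none => exact le_rfl
  | some j => exact (hr j).le

theorem acceptedReward_mono (hr : ∀ j, 0 < r j) {I I' : ℤ} (h : I ≤ I') (d : CycleArrivals M T) :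
    acceptedReward r I d ≤ acceptedReward r I' d :=
  Finset.sum_le_sum_of_subset_of_nonneg (accepted_mono h d) fun _ _ _ => elim_nonneg hr _

theorem acceptedReward_le_totalReward (hr : ∀ j, 0 < r j) (I : ℤ) (d : CycleArrivals M T) :
    acceptedReward r I d ≤ totalReward r d :=
  Finset.sum_le_sum_of_subset_of_nonneg (accepted_subset I d) fun _ _ _ => elim_nonneg hr _

theorem card_sdiff_accepted (I : ℤ) (d : CycleArrivals M T) :
    ((arrivals d \ accepted I d).card : ℝ) = (demand d : ℝ) - sold I d := by
  rw [Finset.card_sdiff_of_subset (accepted_subset I d),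
    Nat.cast_sub (Finset.card_le_card (accepted_subset I d)), card_arrivals]
  simp [sold]

theorem lostReward_eq (r : Fin M → ℝ) (I : ℤ) (d : CycleArrivals M T) :
    totalReward r d - acceptedReward r I d =
      ∑ t ∈ arrivals d \ accepted I d, (d t).elim 0 r := by
  rw [totalReward, acceptedReward, ← Finset.sum_sdiff (accepted_subset I d), add_sub_cancel_right]

theorem le_lostReward {lo : ℝ} (hlo : ∀ j, lo ≤ r j) (I : ℤ) (d : CycleArrivals M T) :
    lo * ((demand d : ℝ) - sold I d) ≤ totalReward r d - acceptedReward r I d := by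
  rw [lostReward_eq, ← card_sdiff_accepted, mul_comm, ← nsmul_eq_mul]
  refine Finset.card_nsmul_le_sum _ _ _ fun t ht => ?_
  have ht' := (Finset.mem_sdiff.1 ht).1
  simp only [arrivals, Finset.mem_filter, Option.isSome_iff_exists] at ht'
  obtain ⟨-, j, hj⟩ := ht'
  simpa [hj] using hlo j

theorem lostReward_le {hi : ℝ} (hhi : ∀ j, r j ≤ hi) (I : ℤ) (d : CycleArrivals M T) :
    totalReward r d - acceptedReward r I d ≤ hi * ((demand d : ℝ) - sold I d) := by
  rw [lostReward_eq, ← card_sdiff_accepted, mul_comm, ← nsmul_eq_mul]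
  refine Finset.sum_le_card_nsmul _ _ _ fun t ht => ?_
  have ht' := (Finset.mem_sdiff.1 ht).1
  simp only [arrivals, Finset.mem_filter, Option.isSome_iff_exists] at ht'
  obtain ⟨-, j, hj⟩ := ht'
  simpa [hj] using hhi j

theorem cycleProfit_eq (r : Fin M → ℝ) (h : ℝ) (I : ℤ) (d : CycleArrivals M T) :
    cycleProfit r h I d = acceptedReward r I d - h * endInv I d := rfl

/-- Charging each lost sale only the least reward understates the loss. This and its counterpart
below reduce profits to uniform-penalty costs. -/
theorem cycleProfit_le {lo : ℝ} (hlo : ∀ j, lo ≤ r j) (h : ℝ) (I : ℤ) (d : CycleArrivals M T) :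
    cycleProfit r h I d ≤ totalReward r d - cycleLostSalesCost h lo I d := by
  have := le_lostReward hlo I d
  rw [cycleProfit_eq, cycleLostSalesCost]
  linarith

theorem le_cycleProfit {hi : ℝ} (hhi : ∀ j, r j ≤ hi) (h : ℝ) (I : ℤ) (d : CycleArrivals M T) :
    totalReward r d - cycleLostSalesCost h hi I d ≤ cycleProfit r h I d := by
  have := lostReward_le hhi I d
  rw [cycleProfit_eq, cycleLostSalesCost]
  linarith

end CycleLemmas

/-! ### Pipeline dynamics and the finite state space -/

section Inventory

variable {L S : ℕ}

/-- Right after ordering in cycle `n` the inventory position is `S`. By cycle `n + L` exactly these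
units have arrived, and only the withdrawals of the `L` cycles in between are missing. The sequence
`out` is arbitrary, so this covers both the lost-sales and the backorder system. -/
theorem inv_add_of_nextState (hL : 1 ≤ L) {s : ℕ → StockState} {out : ℕ → ℤ}
    (hs : ∀ n, s (n + 1) = nextState L S (s n) (out n)) (n : ℕ) :
    (s (n + L)).inv = S - ∑ i ∈ Finset.range L, out (n + i) := by
  -- What is due `l` cycles after `n + j` is due `l + j` cycles after `n`; the bound `l + j ≤ L`
  -- says that it was already ordered by cycle `n`.
  have hpipe : ∀ j l, 1 ≤ l → l + j ≤ L →
      pipeAfterOrder L S (s (n + j)) l = pipeAfterOrder L S (s n) (l + j) := by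
    intro j
    induction j with
    | zero => simp
    | succ j ih =>
      intro l hl hlj
      have h1 : pipeAfterOrder L S (s (n + (j + 1))) l = (s (n + (j + 1))).pipe l :=
        if_neg (by omega)
      rw [h1, ← add_assoc, hs]
      change pipeAfterOrder L S (s (n + j)) (l + 1) = _
      rw [ih (l + 1) (by omega) (by omega)]
      congr 1
      omega
  have hinv : ∀ j ≤ L, (s (n + j)).inv = (s n).inv - ∑ i ∈ Finset.range j, out (n + i) +
      ∑ l ∈ Finset.range j, pipeAfterOrder L S (s n) (l + 1) := by
    intro j
    induction j with
    | zero => simp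
    | succ j ih =>
      intro hj
      rw [← add_assoc, hs]
      change (s (n + j)).inv - out (n + j) + pipeAfterOrder L S (s (n + j)) 1 = _
      rw [hpipe j 1 le_rfl (by omega), ih (by omega), Finset.sum_range_succ,
        Finset.sum_range_succ, add_comm 1 j]
      ring
  rw [hinv L le_rfl]
  obtain ⟨K, rfl⟩ : ∃ K, L = K + 1 := ⟨L - 1, by omega⟩
  rw [Finset.sum_range_succ (fun l => pipeAfterOrder (K + 1) S (s n) (l + 1))]
  have h1 : pipeAfterOrder (K + 1) S (s n) (K + 1) = order (K + 1) S (s n) := if_pos rfl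
  have h2 : ∑ l ∈ Finset.range K, pipeAfterOrder (K + 1) S (s n) (l + 1) =
      ∑ l ∈ Finset.Icc 1 (K + 1 - 1), (s n).pipe l := by
    rw [Nat.add_sub_cancel, ← Finset.Ico_add_one_right_eq_Icc, Finset.sum_Ico_eq_sum_range]
    refine Finset.sum_congr rfl fun l hl => ?_
    rw [add_comm 1 l]
    exact if_neg (by simp at hl; omega)
  rw [h1, h2, order]
  ring

/-- Erase the unused pipeline entries of a state. -/
def StockState.truncate (L : ℕ) (s : StockState) : StockState where
  inv := s.inv
  pipe := fun l => if l ∈ Finset.Icc 1 (L - 1) then s.pipe l else 0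

theorem order_truncate (s : StockState) : order L S (s.truncate L) = order L S s := by
  have : ∑ l ∈ Finset.Icc 1 (L - 1), (s.truncate L).pipe l =
      ∑ l ∈ Finset.Icc 1 (L - 1), s.pipe l :=
    Finset.sum_congr rfl fun l hl => if_pos hl
  rw [order, this]
  rfl

theorem pipeAfterOrder_truncate (s : StockState) {l : ℕ} (hl : l ∈ Finset.Icc 1 L) :
    pipeAfterOrder L S (s.truncate L) l = pipeAfterOrder L S s l := by
  unfold pipeAfterOrder
  split_ifs with h
  · exact order_truncate s
  · exact if_pos (by simp at hl ⊢; omega)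

/-- Unused pipeline entries never influence the used ones, so `truncate` is a lumping of the chain.
-/
theorem truncate_nextState (hL : 1 ≤ L) (s : StockState) (out : ℤ) :
    (nextState L S s out).truncate L = (nextState L S (s.truncate L) out).truncate L := by
  unfold nextState
  rw [pipeAfterOrder_truncate s (by simp; omega)]
  simp only [StockState.truncate, StockState.mk.injEq, true_and]
  funext l
  split_ifs with hl
  · exact (pipeAfterOrder_truncate s (by simp at hl ⊢; omega)).symm
  · rfl

theorem truncate_truncate (s : StockState) : (s.truncate L).truncate L = s.truncate L := by
  simp only [StockState.truncate, StockState.mk.injEq, true_and]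
  funext l
  split_ifs <;> rfl

theorem StockState.Feasible.truncate {s : StockState} (hs : s.Feasible L S) :
    (s.truncate L).Feasible L S where
  inv_nonneg := hs.inv_nonneg
  pipe_nonneg := fun l hl => by
    have := hs.pipe_nonneg l hl
    have h : (s.truncate L).pipe l = s.pipe l := if_pos hl
    rwa [h]
  position_le := by
    have := hs.position_le
    rwa [StockState.truncate, Finset.sum_congr rfl fun l hl => if_pos hl]

theorem StockState.Feasible.inv_le {s : StockState} (hs : s.Feasible L S) : s.inv ≤ S := by
  have := Finset.sum_nonneg hs.pipe_nonneg
  linarith [hs.position_le]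

theorem StockState.Feasible.pipe_le {s : StockState} (hs : s.Feasible L S) {l : ℕ}
    (hl : l ∈ Finset.Icc 1 (L - 1)) : s.pipe l ≤ S := by
  have := Finset.single_le_sum hs.pipe_nonneg hl
  linarith [hs.position_le, hs.inv_nonneg]

theorem StockState.Feasible.nextState {s : StockState} (hL : 1 ≤ L) (hs : s.Feasible L S)
    {out : ℤ} (h0 : 0 ≤ out) (h1 : out ≤ s.inv) : (nextState L S s out).Feasible L S := by
  have hord : 0 ≤ order L S s := by
    rw [order]
    linarith [hs.position_le]
  have hq : ∀ l ∈ Finset.Icc 1 L, 0 ≤ pipeAfterOrder L S s l := by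
    intro l hl
    unfold pipeAfterOrder
    split_ifs with h
    · exact hord
    · exact hs.pipe_nonneg l (by simp at hl ⊢; omega)
  refine ⟨?_, fun l hl => hq (l + 1) (by simp at hl ⊢; omega), ?_⟩
  · have := hq 1 (by simp; omega)
    change 0 ≤ s.inv - out + pipeAfterOrder L S s 1
    linarith
  · change s.inv - out + pipeAfterOrder L S s 1 +
      ∑ l ∈ Finset.Icc 1 (L - 1), pipeAfterOrder L S s (l + 1) ≤ S
    obtain ⟨K, rfl⟩ : ∃ K, L = K + 1 := ⟨L - 1, by omega⟩
    have e1 : pipeAfterOrder (K + 1) S s 1 +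
        ∑ l ∈ Finset.Icc 1 (K + 1 - 1), pipeAfterOrder (K + 1) S s (l + 1) =
        ∑ l ∈ Finset.range (K + 1), pipeAfterOrder (K + 1) S s (l + 1) := by
      rw [Finset.sum_range_succ', Nat.add_sub_cancel, ← Finset.Ico_add_one_right_eq_Icc,
        Finset.sum_Ico_eq_sum_range, add_comm]
      simp only [Nat.add_sub_cancel, zero_add, add_comm 1]
    have e2 : ∑ l ∈ Finset.range K, pipeAfterOrder (K + 1) S s (l + 1) =
        ∑ l ∈ Finset.Icc 1 (K + 1 - 1), s.pipe l := by
      rw [Nat.add_sub_cancel, ← Finset.Ico_add_one_right_eq_Icc, Finset.sum_Ico_eq_sum_range]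
      refine Finset.sum_congr rfl fun l hl => ?_
      rw [add_comm 1 l]
      exact if_neg (by simp at hl; omega)
    rw [add_assoc, e1, Finset.sum_range_succ, e2]
    have e3 : pipeAfterOrder (K + 1) S s (K + 1) = order (K + 1) S s := if_pos rfl
    rw [e3, order]
    linarith

theorem finite_truncated_feasible (L S : ℕ) :
    {s : StockState | s.Feasible L S ∧ s.truncate L = s}.Finite := by
  -- Index `0` lies outside `Finset.Icc 1 (L - 1)`, so that coordinate records the inventory; all
  -- coordinates lie between `0` and `S`.
  refine Set.Finite.of_injOn (f := fun s (i : Fin (L + 1)) => if (i : ℕ) ∈ Finset.Icc 1 (L - 1) then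
    s.pipe i else s.inv) (t := Set.Icc (fun _ => 0) fun _ => (S : ℤ)) ?_ ?_ (Set.finite_Icc _ _)
  · rintro s ⟨hs, -⟩
    constructor
    · intro i
      change (0 : ℤ) ≤ ite _ _ _
      split_ifs with hi
      · exact hs.pipe_nonneg _ hi
      · exact hs.inv_nonneg
    · intro i
      change ite _ _ _ ≤ (S : ℤ)
      split_ifs with hi
      · exact hs.pipe_le hi
      · exact hs.inv_le
  · rintro s ⟨-, hs⟩ s' ⟨-, hs'⟩ h
    rw [← hs, ← hs']
    simp only [StockState.truncate, StockState.mk.injEq]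
    constructor
    · simpa using congrFun h 0
    · funext l
      split_ifs with hl
      · simpa only [hl, if_true] using congrFun h ⟨l, by simp at hl; omega⟩
      · rfl

end Inventory

/-! ### Pathwise coupling of the lost-sales and backorder systems -/

section BaseStock

variable {M T L S : ℕ}

theorem baseState_eq_chainState (s : StockState) (H : ArrivalPath M T) (n : ℕ) :
    baseState L S s H n =
      chainState (fun s d => nextState L S s (sold s.inv d)) s H n := by
  induction n with
  | zero => rfl
  | succ n ih => simp only [baseState, chainState, ih]

theorem backorderState_eq_chainState (s : StockState) (H : ArrivalPath M T) (n : ℕ) :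
    backorderState L S s H n = chainState (fun s d => nextState L S s (demand d)) s H n := by
  induction n with
  | zero => rfl
  | succ n ih => simp only [backorderState, chainState, ih]

theorem sold_nonneg (I : ℤ) (d : CycleArrivals M T) : 0 ≤ sold I d := Int.natCast_nonneg _

theorem sold_le {I : ℤ} (hI : 0 ≤ I) (d : CycleArrivals M T) : sold I d ≤ I := by
  rw [sold_eq_min hI]
  exact min_le_left _ _

theorem feasible_baseState (hL : 1 ≤ L) {s : StockState} (hs : s.Feasible L S)
    (H : ArrivalPath M T) (n : ℕ) : (baseState L S s H n).Feasible L S := by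
  induction n with
  | zero => exact hs
  | succ n ih => exact ih.nextState hL (sold_nonneg _ _) (sold_le ih.inv_nonneg _)

/-- Net inventory at the end of cycle `L` in the backorder system with level `S`. -/
def netInv (L S : ℕ) (H : ArrivalPath M T) : ℤ :=
  S - (∑ i ∈ Finset.range (L + 1), demand (H i) : ℕ)

/-- Lost sales of a cycle. -/
def lost (I : ℤ) (d : CycleArrivals M T) : ℤ := demand d - sold I d

theorem lost_nonneg (I : ℤ) (d : CycleArrivals M T) : 0 ≤ lost I d :=
  sub_nonneg.2 (sold_le_demand I d)

theorem lost_le (I : ℤ) (d : CycleArrivals M T) : lost I d ≤ T := by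
  have := demand_le d
  have := sold_nonneg I d
  unfold lost
  omega

/-- Both systems start from position `S` in cycle `n`; over the next `L + 1` cycles they differ only
in that lost demand is not deducted. -/
theorem endInv_eq_netInv_add (hL : 1 ≤ L) (s : StockState) (H : ArrivalPath M T) (n : ℕ) :
    endInv (baseState L S s H (n + L)).inv (H (n + L)) = netInv L S (fun i => H (i + n)) +
      ∑ j ∈ Finset.range (L + 1), lost (baseState L S s H (n + j)).inv (H (n + j)) := by
  have h := inv_add_of_nextState (S := S) hL (s := baseState L S s H)
    (out := fun n => sold (baseState L S s H n).inv (H n)) (fun n => rfl) n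
  unfold endInv netInv lost
  rw [Finset.sum_sub_distrib, Finset.sum_range_succ (fun j => sold _ _)]
  push_cast
  simp only [add_comm _ n]
  linarith

theorem lost_le_max_netInv (hL : 1 ≤ L) {s : StockState} (hs : s.Feasible L S)
    (H : ArrivalPath M T) (n : ℕ) :
    lost (baseState L S s H (n + L)).inv (H (n + L)) ≤
      max (-netInv L S (fun i => H (i + n))) 0 := by
  have h1 := endInv_eq_netInv_add (S := S) hL s H n
  have h2 : lost (baseState L S s H (n + L)).inv (H (n + L)) ≤
      ∑ j ∈ Finset.range (L + 1), lost (baseState L S s H (n + j)).inv (H (n + j)) :=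
    Finset.single_le_sum (f := fun j => lost (baseState L S s H (n + j)).inv (H (n + j)))
      (fun j _ => lost_nonneg _ _) (Finset.mem_range.2 (Nat.lt_succ_self L))
  have hI := (feasible_baseState hL hs H (n + L)).inv_nonneg
  have h3 := sold_eq_min hI (H (n + L))
  generalize ∑ j ∈ Finset.range (L + 1),
    lost (baseState L S s H (n + j)).inv (H (n + j)) = Λ at h1 h2
  unfold endInv at h1
  -- If a sale is lost, the stock is exhausted. The leftover is then `0`, so the lost sales of the
  -- `L + 1` cycles add up to minus the net inventory.
  by_cases h0 : lost (baseState L S s H (n + L)).inv (H (n + L)) = 0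
  · rw [h0]
    exact le_max_right _ _
  · refine le_trans ?_ (le_max_left _ _)
    unfold lost at h0 h2 ⊢
    omega

/-- The leftover is nonnegative, so the lost sales of the window must cover any backorder shortage.
-/
theorem max_netInv_le (hL : 1 ≤ L) {s : StockState} (hs : s.Feasible L S)
    (H : ArrivalPath M T) (n : ℕ) :
    max (-netInv L S (fun i => H (i + n))) 0 ≤
      ∑ j ∈ Finset.range (L + 1), lost (baseState L S s H (n + j)).inv (H (n + j)) := by
  have h1 := endInv_eq_netInv_add (S := S) hL s H n
  have h2 := endInv_nonneg (feasible_baseState hL hs H (n + L)).inv_nonneg (H (n + L))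
  exact max_le (by linarith) (Finset.sum_nonneg fun j _ => lost_nonneg _ _)

theorem backorderState_inv (hL : 1 ≤ L) (s : StockState) (H : ArrivalPath M T) (n : ℕ) :
    (backorderState L S s H (n + L)).inv - demand (H (n + L)) =
      netInv L S (fun i => H (i + n)) := by
  have h := inv_add_of_nextState (S := S) hL (s := backorderState L S s H)
    (out := fun n => demand (H n)) (fun n => rfl) n
  rw [h, netInv, Finset.sum_range_succ]
  push_cast
  simp only [add_comm n]
  ring

end BaseStock

/-! ### Exact cost of the backorder system -/

section BackorderValue

variable {M T L S : ℕ}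

theorem demandProb_eq_zero {l0 : ℝ} {n k : ℕ} (h : n * T < k) : demandProb T l0 n k = 0 := by
  simp [demandProb, Nat.choose_eq_zero_of_lt h]

theorem sum_Icc_demandProb_excess (l0 : ℝ) (n m : ℕ) :
    ∑ k ∈ Finset.Icc 0 m, ((m : ℝ) - k) * demandProb T l0 n k =
      ∑ k ∈ Finset.range (n * T + 1), demandProb T l0 n k * max ((m : ℝ) - k) 0 := by
  have h1 : ∑ k ∈ Finset.Icc 0 m, ((m : ℝ) - k) * demandProb T l0 n k =
      ∑ k ∈ Finset.range (m + n * T + 1), demandProb T l0 n k * max ((m : ℝ) - k) 0 := by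
    have : ∀ k ∈ Finset.Icc 0 m, ((m : ℝ) - k) * demandProb T l0 n k =
        demandProb T l0 n k * max ((m : ℝ) - k) 0 := fun k hk => by
      have : (k : ℝ) ≤ m := by exact_mod_cast (Finset.mem_Icc.1 hk).2
      rw [max_eq_left (by linarith), mul_comm]
    rw [Finset.sum_congr rfl this]
    refine Finset.sum_subset (fun k hk => by simp at hk ⊢; omega) fun k _ hk => ?_
    have : (m : ℝ) ≤ k := by exact_mod_cast (by simp at hk; omega : m ≤ k)
    rw [max_eq_right (by linarith), mul_zero]
  rw [h1]
  refine (Finset.sum_subset (fun k hk => by simp at hk ⊢; omega) fun k _ hk => ?_).symm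
  rw [demandProb_eq_zero (by simp at hk; omega), zero_mul]

theorem sum_Icc_demandProb_shortage (l0 : ℝ) (n m : ℕ) :
    ∑ k ∈ Finset.Icc (m + 1) (n * T), ((k : ℝ) - m) * demandProb T l0 n k =
      ∑ k ∈ Finset.range (n * T + 1), demandProb T l0 n k * max ((k : ℝ) - m) 0 := by
  have : ∀ k ∈ Finset.Icc (m + 1) (n * T), ((k : ℝ) - m) * demandProb T l0 n k =
      demandProb T l0 n k * max ((k : ℝ) - m) 0 := fun k hk => by
    have : (m : ℝ) ≤ k := by exact_mod_cast (by simp at hk; omega : m ≤ k)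
    rw [max_eq_left (by linarith), mul_comm]
  rw [Finset.sum_congr rfl this]
  refine Finset.sum_subset (fun k hk => by simp at hk ⊢; omega) fun k hk hk' => ?_
  have : (k : ℝ) ≤ m := by exact_mod_cast (by simp at hk hk'; omega : k ≤ m)
  rw [max_eq_right (by linarith), mul_zero]

/-- Long-run average cost of the backorder system with penalty `b`. -/
noncomputable def backorderValue (T : ℕ) (l0 h b : ℝ) (L S : ℕ) : ℝ :=
  h * (∑ k ∈ Finset.Icc 0 S, ((S : ℝ) - k) * demandProb T l0 (L + 1) k) +
    b * ∑ k ∈ Finset.Icc (S + 1) ((L + 1) * T), ((k : ℝ) - S) * demandProb T l0 (L + 1) k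

theorem dependsOn_netInv (f : ℤ → ℝ) :
    DependsOn (fun H : ArrivalPath M T => f (netInv L S H)) (Set.Iio (L + 1)) :=
  dependsOn_sum_demand (L + 1) fun k => f (S - (k : ℕ))

variable {Ω : Type*} [MeasurableSpace Ω] {P : Measure Ω} [IsProbabilityMeasure P]
  {lam : Fin M → ℝ} {X : Ω → ArrivalPath M T}

theorem IsArrivalProcess.integral_backorder (hX : IsArrivalProcess P lam X)
    (hlam : ∀ j, 0 ≤ lam j) (h b : ℝ) :
    ∫ ω, (h * max (netInv L S (X ω) : ℝ) 0 + b * max (-(netInv L S (X ω) : ℝ)) 0) ∂P =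
      backorderValue T (lam0 lam) h b L S := by
  have := hX.integral_demand hlam (L + 1)
    fun k => h * max ((S : ℝ) - k) 0 + b * max ((k : ℝ) - S) 0
  rw [backorderValue, sum_Icc_demandProb_excess, sum_Icc_demandProb_shortage, Finset.mul_sum,
    Finset.mul_sum, ← Finset.sum_add_distrib]
  refine Eq.trans ?_ (this.trans (Finset.sum_congr rfl fun k _ => by ring))
  simp only [netInv, Int.cast_sub, Int.cast_natCast, neg_sub]

/-- Uses `x⁺ = x + x⁻`. In this form only the mean negative part carries the penalty, which makes
different penalties comparable. -/
theorem IsArrivalProcess.backorderValue_eq (hX : IsArrivalProcess P lam X)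
    (hlam : ∀ j, 0 ≤ lam j) (h b : ℝ) :
    backorderValue T (lam0 lam) h b L S = h * ∫ ω, (netInv L S (X ω) : ℝ) ∂P +
      (h + b) * ∫ ω, max (-(netInv L S (X ω) : ℝ)) 0 ∂P := by
  rw [← hX.integral_backorder hlam, ← integral_const_mul, ← integral_const_mul, ← integral_add]
  · refine integral_congr_ae (.of_forall fun ω => ?_)
    simp only
    rcases le_total (netInv L S (X ω) : ℝ) 0 with h0 | h0
    · rw [max_eq_right h0, max_eq_left (by linarith)]
      ring
    · rw [max_eq_left h0, max_eq_right (by linarith)]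
      ring
  · exact (hX.integrable (dependsOn_netInv fun z => (z : ℝ))).const_mul _
  · exact (hX.integrable (dependsOn_netInv fun z => max (-(z : ℝ)) 0)).const_mul _

theorem le_netInv (H : ArrivalPath M T) : (S : ℝ) - (L + 1) * T ≤ netInv L S H := by
  have : ∑ i ∈ Finset.range (L + 1), demand (H i) ≤ (L + 1) * T := by
    refine (Finset.sum_le_card_nsmul _ _ T fun i _ => demand_le _).trans ?_
    simp
  have h' : ((∑ i ∈ Finset.range (L + 1), demand (H i) : ℕ) : ℝ) ≤ (L + 1) * T := by
    exact_mod_cast this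
  rw [netInv]
  push_cast at h' ⊢
  linarith

theorem IsArrivalProcess.le_integral_netInv (hX : IsArrivalProcess P lam X) :
    (S : ℝ) - (L + 1) * T ≤ ∫ ω, (netInv L S (X ω) : ℝ) ∂P := by
  have := integral_mono (μ := P) (integrable_const _)
    (hX.integrable (dependsOn_netInv fun z => (z : ℝ))) fun ω => le_netInv (L := L) (S := S) (X ω)
  simpa using this

/-- Linear growth in `S`, which forces a minimizing level to exist. -/
theorem IsArrivalProcess.le_backorderValue (hX : IsArrivalProcess P lam X)
    (hlam : ∀ j, 0 ≤ lam j) {h b : ℝ} (hh : 0 < h) (hb : 0 < b) :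
    h * ((S : ℝ) - (L + 1) * T) ≤ backorderValue T (lam0 lam) h b L S := by
  rw [hX.backorderValue_eq hlam]
  have h1 := mul_le_mul_of_nonneg_left (hX.le_integral_netInv (L := L) (S := S)) hh.le
  have h2 : 0 ≤ (h + b) * ∫ ω, max (-(netInv L S (X ω) : ℝ)) 0 ∂P :=
    mul_nonneg (by linarith) (integral_nonneg fun ω => le_max_right _ _)
  linarith

theorem dependsOn_backorderCost (h b : ℝ) (init : ℕ → StockState) (n : ℕ) :
    DependsOn (fun H : ArrivalPath M T => backorderCost h b L init S H n) (Set.Iio (n + 1)) := by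
  simp only [backorderCost, backorderState_eq_chainState]
  exact dependsOn_chainState (fun (s : StockState) d => cycleBackorderCost h b s.inv d) _ n

theorem IsArrivalProcess.hasLongRunAverage_backorderCost (hX : IsArrivalProcess P lam X)
    (hlam : ∀ j, 0 ≤ lam j) (hL : 1 ≤ L) (h b : ℝ) (init : ℕ → StockState) :
    HasLongRunAverage P X (backorderCost h b L init S)
      (backorderValue T (lam0 lam) h b L S : ℝ) := by
  rw [hX.hasLongRunAverage_coe_iff (dependsOn_backorderCost h b init)]
  -- From cycle `L` on the initial state is forgotten and the expected cost is constant, by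
  -- stationarity.
  refine .of_tendsto (tendsto_const_nhds.congr' ?_)
  filter_upwards [eventually_ge_atTop L] with m hm
  obtain ⟨n, rfl⟩ := Nat.exists_eq_add_of_le' hm
  rw [← hX.integral_backorder hlam, ← hX.integral_shift hlam (dependsOn_netInv
    fun z => h * max (z : ℝ) 0 + b * max (-(z : ℝ)) 0) n]
  refine integral_congr_ae (.of_forall fun ω => ?_)
  simp only [backorderCost, cycleBackorderCost, ← backorderState_inv hL (init S) (X ω) n]
  push_cast
  rw [neg_sub]

end BackorderValue

/-! ### Average profit of base-stock policies -/

section BaseStockValue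

variable {M T L S : ℕ} {Ω : Type*} [MeasurableSpace Ω] {P : Measure Ω} [IsProbabilityMeasure P]
  {lam : Fin M → ℝ} {X : Ω → ArrivalPath M T}

theorem dependsOn_baseState (g : ℤ → CycleArrivals M T → ℝ) (s : StockState) (n : ℕ) :
    DependsOn (fun H : ArrivalPath M T => g (baseState L S s H n).inv (H n))
      (Set.Iio (n + 1)) := by
  simp only [baseState_eq_chainState]
  exact dependsOn_chainState (fun (s : StockState) d => g s.inv d) _ n

theorem IsArrivalProcess.exists_cesaroTendsto_baseState (hX : IsArrivalProcess P lam X)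
    (hlam : ∀ j, 0 ≤ lam j) (hlam_sum : ∑ j, lam j ≤ 1) (hL : 1 ≤ L) {s : StockState}
    (hs : s.Feasible L S) (g : ℤ → CycleArrivals M T → ℝ) :
    ∃ v, CesaroTendsto (fun n => ∫ ω, g (baseState L S s (X ω) n).inv (X ω n) ∂P) v := by
  simp only [baseState_eq_chainState]
  have h1 : ∀ n, ∫ ω, g (chainState (fun s d => nextState L S s (sold s.inv d)) s (X ω) n).inv
      (X ω n) ∂P = chainExp (cycleProb lam)
        (fun s d => (nextState L S s (sold s.inv d)).truncate L) (fun s d => g s.inv d) n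
        (s.truncate L) := fun n => by
    rw [hX.integral_chainState (φ := fun s d => nextState L S s (sold s.inv d)) hlam
      (fun s d => g s.inv d), ← chainExp_comp
      (φ := fun s d => nextState L S s (sold s.inv d)) (StockState.truncate L)
      fun s a => truncate_nextState hL s _]
    rfl
  simp only [h1]
  refine exists_cesaroTendsto_chainExp (cycleProb_nonneg hlam hlam_sum) (sum_cycleProb lam) _ _
    (finite_truncated_feasible L S) ?_ ⟨hs.truncate, truncate_truncate s⟩
  rintro s ⟨hs, -⟩ a
  exact ⟨(hs.nextState hL (sold_nonneg _ _) (sold_le hs.inv_nonneg _)).truncate,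
    truncate_truncate _⟩

theorem IsArrivalProcess.integral_totalReward (hX : IsArrivalProcess P lam X)
    (hlam : ∀ j, 0 ≤ lam j) (r : Fin M → ℝ) (n : ℕ) :
    ∫ ω, totalReward r (X ω n) ∂P = ∑ d : CycleArrivals M T, cycleProb lam d * totalReward r d := by
  have hF : DependsOn (fun H : ArrivalPath M T => totalReward r (H 0)) (Set.Iio (0 + 1)) :=
    fun H H' h => by
      simp only
      rw [h 0 (by simp)]
  have := hX.integral_shift hlam hF n
  simp only [zero_add] at this
  rw [this, hX.integral_first_step hlam hF]
  simp [consPath]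

/-- The average profit of a base-stock policy exists, and it is bounded by means of backorder
costs with the same base-stock level. -/
theorem IsArrivalProcess.exists_baseProfit (hX : IsArrivalProcess P lam X)
    (hlam : ∀ j, 0 ≤ lam j) (hlam_sum : ∑ j, lam j ≤ 1) (hL : 1 ≤ L) {init : ℕ → StockState}
    (hs : (init S).Feasible L S) {r : Fin M → ℝ} {h lo hi : ℝ} (hh : 0 < h) (hlo0 : 0 < lo)
    (hlo : ∀ j, lo ≤ r j) (hhi0 : 0 < hi) (hhi : ∀ j, r j ≤ hi) :
    ∃ v : ℝ, HasLongRunAverage P X (baseProfit r h L init S) v ∧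
      (∑ d : CycleArrivals M T, cycleProb lam d * totalReward r d) -
        backorderValue T (lam0 lam) h (hi + L * h) L S ≤ v ∧
      v ≤ (∑ d : CycleArrivals M T, cycleProb lam d * totalReward r d) -
        backorderValue T (lam0 lam) h (lo / (L + 1)) L S ∧
      v ≤ (∑ d : CycleArrivals M T, cycleProb lam d * totalReward r d) -
        h * ((S : ℝ) - (L + 1) * T) := by
  set R := ∑ d : CycleArrivals M T, cycleProb lam d * totalReward r d
  obtain ⟨v, hv⟩ := hX.exists_cesaroTendsto_baseState hlam hlam_sum hL hs (cycleProfit r h)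
  obtain ⟨ℓ, hℓ⟩ := hX.exists_cesaroTendsto_baseState hlam hlam_sum hL hs fun I d => (lost I d : ℝ)
  obtain ⟨e, he⟩ := hX.exists_cesaroTendsto_baseState hlam hlam_sum hL hs
    fun I d => (endInv I d : ℝ)
  have hint : ∀ (g : ℤ → CycleArrivals M T → ℝ) (n : ℕ),
      Integrable (fun ω => g (baseState L S (init S) (X ω) n).inv (X ω n)) P := fun g n =>
    hX.integrable (dependsOn_baseState g (init S) n)
  have hfeas := fun ω n => feasible_baseState hL hs (X ω) n
  have hℓB : ∀ n, |∫ ω, (lost (baseState L S (init S) (X ω) n).inv (X ω n) : ℝ) ∂P| ≤ T := by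
    intro n
    have h0 : ∀ ω, (0 : ℝ) ≤ lost (baseState L S (init S) (X ω) n).inv (X ω n) := fun ω => by
      exact_mod_cast lost_nonneg _ _
    rw [abs_of_nonneg (integral_nonneg h0)]
    have := integral_mono (hint (fun I d => (lost I d : ℝ)) n) (integrable_const (T : ℝ))
      fun ω => by simpa using (Int.cast_le (R := ℝ)).2 (lost_le _ _)
    simpa using this
  have heB : ∀ n, |∫ ω, (endInv (baseState L S (init S) (X ω) n).inv (X ω n) : ℝ) ∂P| ≤ S := by
    intro n
    have h0 : ∀ ω, (0 : ℝ) ≤ endInv (baseState L S (init S) (X ω) n).inv (X ω n) := fun ω => by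
      exact_mod_cast endInv_nonneg (hfeas ω n).inv_nonneg _
    rw [abs_of_nonneg (integral_nonneg h0)]
    have := integral_mono (hint (fun I d => (endInv I d : ℝ)) n) (integrable_const (S : ℝ))
      fun ω => by
        have h1 := (hfeas ω n).inv_le
        have h2 := sold_nonneg (baseState L S (init S) (X ω) n).inv (X ω n)
        have : endInv (baseState L S (init S) (X ω) n).inv (X ω n) ≤ S := by
          unfold endInv
          omega
        have h3 := (Int.cast_le (R := ℝ)).2 this
        push_cast at h3
        exact h3
    simpa using this
  set β := ∫ ω, (netInv L S (X ω) : ℝ) ∂P with hβ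
  set βneg := ∫ ω, max (-(netInv L S (X ω) : ℝ)) 0 ∂P with hβneg
  have hβn : ∀ n, ∫ ω, (netInv L S (fun i => X ω (i + n)) : ℝ) ∂P = β := fun n =>
    hX.integral_shift hlam (dependsOn_netInv fun z => (z : ℝ)) n
  have hβnegn : ∀ n, ∫ ω, max (-(netInv L S (fun i => X ω (i + n)) : ℝ)) 0 ∂P = βneg := fun n =>
    hX.integral_shift hlam (dependsOn_netInv fun z => max (-(z : ℝ)) 0) n
  have hnet : ∀ (f : ℤ → ℝ) n, Integrable (fun ω => f (netInv L S fun i => X ω (i + n))) P := by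
    intro f n
    refine hX.integrable (n := L + 1 + n) (F := fun H => f (netInv L S fun i => H (i + n)))
      fun H H' hH => ?_
    exact dependsOn_netInv f fun i hi => hH _ (by simp at hi ⊢; omega)
  have hsumL : CesaroTendsto (fun n => ∑ j ∈ Finset.range (L + 1),
      ∫ ω, (lost (baseState L S (init S) (X ω) (n + j)).inv (X ω (n + j)) : ℝ) ∂P)
      ((L + 1) * ℓ) := by
    have := CesaroTendsto.sum (Finset.range (L + 1)) fun j _ => hℓ.shift hℓB j
    simpa using this
  have hsumint : ∀ n, ∫ ω, ∑ j ∈ Finset.range (L + 1),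
      (lost (baseState L S (init S) (X ω) (n + j)).inv (X ω (n + j)) : ℝ) ∂P =
      ∑ j ∈ Finset.range (L + 1),
        ∫ ω, (lost (baseState L S (init S) (X ω) (n + j)).inv (X ω (n + j)) : ℝ) ∂P := fun n =>
    integral_finsetSum _ fun j _ => hint (fun I d => (lost I d : ℝ)) (n + j)
  have hsumintble : ∀ n, Integrable (fun ω => ∑ j ∈ Finset.range (L + 1),
      (lost (baseState L S (init S) (X ω) (n + j)).inv (X ω (n + j)) : ℝ)) P := fun n =>
    integrable_finsetSum _ fun j _ => hint (fun I d => (lost I d : ℝ)) (n + j)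
  -- The pathwise identity and the two pathwise inequalities are averaged here; shifting a bounded
  -- sequence does not change its Cesàro limit, so each of the `L + 1` lost-sales terms contributes
  -- `ℓ`.
  have h_e : e = β + (L + 1) * ℓ := by
    refine (he.shift heB L).unique (((CesaroTendsto.const β).add hsumL).congr fun N => ?_)
    congr 1
    refine Finset.sum_congr rfl fun n _ => ?_
    simp only
    rw [← hβn n, ← hsumint, ← integral_add (hnet (fun z => (z : ℝ)) n) (hsumintble n)]
    refine integral_congr_ae (.of_forall fun ω => ?_)
    simp only [endInv_eq_netInv_add hL]
    push_cast
    rfl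
  have h_up : ℓ ≤ βneg := by
    refine (hℓ.shift hℓB L).le (CesaroTendsto.const βneg) fun n => ?_
    rw [← hβnegn n]
    refine integral_mono (hint (fun I d => (lost I d : ℝ)) (n + L))
      (hnet (fun z => max (-(z : ℝ)) 0) n) fun ω => ?_
    have h1 := (Int.cast_le (R := ℝ)).2 (lost_le_max_netInv hL hs (X ω) n)
    push_cast at h1
    exact h1
  have h_lo : βneg ≤ (L + 1) * ℓ := by
    refine (CesaroTendsto.const βneg).le hsumL fun n => ?_
    rw [← hβnegn n, ← hsumint]
    refine integral_mono (hnet (fun z => max (-(z : ℝ)) 0) n) (hsumintble n) fun ω => ?_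
    have h1 := (Int.cast_le (R := ℝ)).2 (max_netInv_le hL hs (X ω) n)
    push_cast at h1
    exact h1
  have hcost : ∀ p : ℝ, CesaroTendsto (fun n => ∫ ω, (totalReward r (X ω n) -
      cycleLostSalesCost h p (baseState L S (init S) (X ω) n).inv (X ω n)) ∂P)
      (R + ((-h) * e + (-p) * ℓ)) := by
    intro p
    refine ((CesaroTendsto.const R).add ((he.const_mul (-h)).add (hℓ.const_mul (-p)))).congr
      fun N => ?_
    congr 1
    refine Finset.sum_congr rfl fun n _ => ?_
    simp only
    rw [← integral_const_mul, ← integral_const_mul, show R = ∫ ω, totalReward r (X ω n) ∂P from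
      (hX.integral_totalReward hlam r n).symm, ← integral_add, ← integral_add]
    · refine integral_congr_ae (.of_forall fun ω => ?_)
      simp only [cycleLostSalesCost, lost]
      push_cast
      ring
    · exact hint (fun _ d => totalReward r d) n
    · exact hint (fun I d => (-h) * (endInv I d : ℝ) + (-p) * (lost I d : ℝ)) n
    · exact hint (fun I d => (-h) * (endInv I d : ℝ)) n
    · exact hint (fun I d => (-p) * (lost I d : ℝ)) n
  have hv_lo : R + ((-h) * e + (-hi) * ℓ) ≤ v := (hcost hi).le hv fun n =>
    integral_mono (hint (fun I d => totalReward r d - cycleLostSalesCost h hi I d) n)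
      (hint _ n) fun ω => le_cycleProfit hhi h _ _
  have hv_up : v ≤ R + ((-h) * e + (-lo) * ℓ) := hv.le (hcost lo) fun n =>
    integral_mono (hint _ n) (hint (fun I d => totalReward r d - cycleLostSalesCost h lo I d) n)
      fun ω => cycleProfit_le hlo h _ _
  have hL0 : (0 : ℝ) ≤ L := Nat.cast_nonneg L
  have hℓ0 : 0 ≤ ℓ := by
    have : 0 ≤ βneg := integral_nonneg fun ω => le_max_right _ _
    by_contra hneg
    nlinarith
  refine ⟨v, ?_, ?_, ?_, ?_⟩
  · exact (hX.hasLongRunAverage_coe_iff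
      (dependsOn_baseState (cycleProfit r h) (init S)) v).2 hv
  · rw [hX.backorderValue_eq hlam, ← hβ, ← hβneg]
    -- The coefficient is `h + b` for `b = hi + L * h`.
    have : (h * (L + 1) + hi) * ℓ ≤ (h * (L + 1) + hi) * βneg :=
      mul_le_mul_of_nonneg_left h_up (by positivity)
    rw [h_e] at hv_lo
    nlinarith
  · rw [hX.backorderValue_eq hlam, ← hβ, ← hβneg]
    have h1 : (h + lo / (L + 1)) * βneg ≤ (h + lo / (L + 1)) * ((L + 1) * ℓ) :=
      mul_le_mul_of_nonneg_left h_lo (by positivity)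
    have h2 : (h + lo / (L + 1)) * ((L + 1) * ℓ) = h * ((L + 1) * ℓ) + lo * ℓ := by
      field_simp
    rw [h_e] at hv_up
    linarith
  · have h1 := mul_le_mul_of_nonneg_left (hX.le_integral_netInv (L := L) (S := S)) hh.le
    have h2 : 0 ≤ h * ((L + 1) * ℓ) := by positivity
    have h3 : 0 ≤ lo * ℓ := by positivity
    rw [h_e] at hv_up
    linarith

end BaseStockValue

/-! ### Lindley's recursion and cyclic rotations -/

section Lindley

/-- Lindley's recursion with increments `z`, started at `0`. -/
def lindley (z : ℕ → ℤ) : ℕ → ℤ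
  | 0 => 0
  | n + 1 => max (lindley z n + z n) 0

theorem lindley_nonneg (z : ℕ → ℤ) (n : ℕ) : 0 ≤ lindley z n := by
  cases n with
  | zero => exact le_rfl
  | succ n => exact le_max_right _ _

theorem sum_le_lindley (z : ℕ → ℤ) (n : ℕ) : ∑ i ∈ Finset.range n, z i ≤ lindley z n := by
  induction n with
  | zero => simp [lindley]
  | succ n ih =>
    rw [Finset.sum_range_succ, lindley]
    exact (add_le_add_left ih _).trans (le_max_left _ _)

/-- `lindley z n` is the maximum of the sums over final segments of the first `n` increments, the
empty one included. Dropping the first increment removes only the full sum. -/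
theorem lindley_succ_eq_max (z : ℕ → ℤ) (n : ℕ) :
    lindley z (n + 1) =
      max (lindley (fun i => z (i + 1)) n) (∑ i ∈ Finset.range (n + 1), z i) := by
  induction n with
  | zero => simp [lindley, max_comm]
  | succ n ih =>
    rw [lindley, ih, lindley, Finset.sum_range_succ _ (n + 1)]
    omega

theorem lindley_congr {z z' : ℕ → ℤ} {n : ℕ} (h : ∀ i < n, z i = z' i) :
    lindley z n = lindley z' n := by
  induction n with
  | zero => rfl
  | succ n ih => rw [lindley, lindley, ih fun i hi => h i (by omega), h n (by omega)]

theorem sum_range_periodic_shift {z : ℕ → ℤ} {n : ℕ} (hz : ∀ j, z (j + n) = z j) (i : ℕ) :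
    ∑ j ∈ Finset.range n, z (j + i) = ∑ j ∈ Finset.range n, z j := by
  induction i with
  | zero => rfl
  | succ i ih =>
    have h1 := Finset.sum_range_succ (fun j => z (j + i)) n
    rw [Finset.sum_range_succ'] at h1
    rw [zero_add, add_comm n i, hz, add_left_inj] at h1
    rw [← ih, ← h1]
    exact Finset.sum_congr rfl fun j _ => by rw [add_right_comm, add_assoc]

/-- The combinatorial core of Spitzer's identity: over all rotations of a finite sequence, the gain
of the running maximum from one more increment adds up to the positive part of the total. -/
theorem sum_rotations_lindley {z : ℕ → ℤ} {m : ℕ} (hz : ∀ j, z (j + (m + 1)) = z j) :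
    ∑ i ∈ Finset.range (m + 1), (lindley (fun j => z (j + i)) (m + 1) -
      lindley (fun j => z (j + (i + 1))) m) = max (∑ i ∈ Finset.range (m + 1), z i) 0 := by
  have hsum := sum_range_periodic_shift hz
  set s := ∑ i ∈ Finset.range (m + 1), z i with hs
  -- Every rotation has the same total `s`. If `s ≤ 0`, the maximum below is attained by its first
  -- argument and each gain is `0`.
  have htail : ∀ i, lindley (fun j => z (j + i)) (m + 1) =
      max (lindley (fun j => z (j + (i + 1))) m) s := fun i => by
    rw [lindley_succ_eq_max, hsum i]
    simp only [add_right_comm _ 1 i, add_assoc]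
  rcases le_total s 0 with h0 | h0
  · rw [max_eq_right h0]
    refine Finset.sum_eq_zero fun i _ => ?_
    rw [htail, max_eq_left (h0.trans (lindley_nonneg _ _)), sub_self]
  · rw [max_eq_left h0]
    -- For `s ≥ 0` the truncation at `0` in the last step is inactive. The gain is then an increment
    -- minus a difference that telescopes to `0` around the period, so the gains add up to `s`.
    have hterm : ∀ i, lindley (fun j => z (j + i)) (m + 1) -
        lindley (fun j => z (j + (i + 1))) m =
        z (i + m) - (lindley (fun j => z (j + (i + 1))) m - lindley (fun j => z (j + i)) m) := by
      intro i
      have h1 := sum_le_lindley (fun j => z (j + i)) m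
      have h2 := hsum i
      rw [Finset.sum_range_succ] at h2
      rw [lindley, add_comm i m, max_eq_left (by linarith)]
      ring
    simp only [hterm]
    rw [Finset.sum_sub_distrib, Finset.sum_range_sub fun i => lindley (fun j => z (j + i)) m,
      hsum m]
    simp only [hz, add_zero, sub_self, sub_zero]

end Lindley

/-! ### Spitzer's identity and the constant-order policy -/

section ConstantOrder

variable {M T : ℕ}

/-- Net supply of a cycle under constant orders. -/
def netSupply (c : ℕ) (d : CycleArrivals M T) : ℤ := c - demand d

theorem constInv_eq_lindley (c : ℕ) (H : ArrivalPath M T) (n : ℕ) :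
    constInv c H n = lindley (fun i => netSupply c (H i)) n + c := by
  induction n with
  | zero => simp [constInv, lindley]
  | succ n ih =>
    have := lindley_nonneg (fun i => netSupply c (H i)) n
    rw [constInv, endInv_eq_max (by omega), ih, lindley, netSupply]
    congr 2
    ring

theorem endInv_constInv (c : ℕ) (H : ArrivalPath M T) (n : ℕ) :
    endInv (constInv c H n) (H n) = lindley (fun i => netSupply c (H i)) (n + 1) := by
  have := constInv_eq_lindley c H (n + 1)
  rw [constInv] at this
  exact add_right_cancel this

theorem constInv_eq_chainState (c : ℕ) (H : ArrivalPath M T) (n : ℕ) :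
    constInv c H n = chainState (fun (I : ℤ) d => endInv I d + c) (c : ℤ) H n := by
  induction n with
  | zero => rfl
  | succ n ih => simp only [constInv, chainState, ih]

theorem dependsOn_constInv (c : ℕ) (g : ℤ → CycleArrivals M T → ℝ) (n : ℕ) :
    DependsOn (fun H : ArrivalPath M T => g (constInv c H n) (H n)) (Set.Iio (n + 1)) := by
  simp only [constInv_eq_chainState]
  exact dependsOn_chainState (fun (I : ℤ) d => g I d) _ n

theorem dependsOn_lindley (c n : ℕ) :
    DependsOn (fun H : ArrivalPath M T => (lindley (fun i => netSupply c (H i)) n : ℝ))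
      (Set.Iio n) := by
  intro H H' h
  simp only
  rw [lindley_congr fun i hi => by rw [h i hi]]

/-- The term is the mean of the positive part of the net supply of `n + 1` cycles, divided by `n +
1`: the summand in Spitzer's identity. -/
theorem aTwoTerm_eq (l0 : ℝ) (c n : ℕ) :
    aTwoTerm T l0 c n = 1 / ((n : ℝ) + 1) * ∑ k ∈ Finset.range ((n + 1) * T + 1),
      demandProb T l0 (n + 1) k * max ((((n + 1) * c : ℕ) : ℝ) - k) 0 := by
  rw [aTwoTerm, ← sum_Icc_demandProb_excess, Finset.mul_sum]
  refine Finset.sum_congr rfl fun k _ => ?_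
  push_cast
  field_simp

variable {Ω : Type*} [MeasurableSpace Ω] {P : Measure Ω} [IsProbabilityMeasure P]
  {lam : Fin M → ℝ} {X : Ω → ArrivalPath M T}

theorem IsArrivalProcess.aTwoTerm_eq_integral (hX : IsArrivalProcess P lam X)
    (hlam : ∀ j, 0 ≤ lam j) (c n : ℕ) :
    aTwoTerm T (lam0 lam) c n = 1 / ((n : ℝ) + 1) *
      ∫ ω, ((max (∑ i ∈ Finset.range (n + 1), netSupply c (X ω i)) 0 : ℤ) : ℝ) ∂P := by
  rw [aTwoTerm_eq]
  congr 1
  rw [← hX.integral_demand hlam (n + 1) fun k => max ((((n + 1) * c : ℕ) : ℝ) - k) 0]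
  refine integral_congr_ae (.of_forall fun ω => ?_)
  simp [netSupply]

theorem IsArrivalProcess.integrable_max_sum_netSupply (hX : IsArrivalProcess P lam X) (c n : ℕ) :
    Integrable (fun ω => ((max (∑ i ∈ Finset.range n, netSupply c (X ω i)) 0 : ℤ) : ℝ)) P :=
  hX.integrable (n := n)
    (F := fun H => ((max (∑ i ∈ Finset.range n, netSupply c (H i)) 0 : ℤ) : ℝ))
    fun H H' h => by
      simp only
      rw [Finset.sum_congr rfl fun i hi => by rw [h i (by simpa using hi)]]

theorem IsArrivalProcess.aTwoTerm_nonneg (hX : IsArrivalProcess P lam X)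
    (hlam : ∀ j, 0 ≤ lam j) (c n : ℕ) : 0 ≤ aTwoTerm T (lam0 lam) c n := by
  rw [hX.aTwoTerm_eq_integral hlam]
  exact mul_nonneg (by positivity)
    (integral_nonneg fun ω => Int.cast_nonneg (le_max_right _ _))

/-- When `c > T`, each cycle leaves at least one extra unit, so every term is at least `1`. This
confines optimal quantities to `c ≤ T`. -/
theorem IsArrivalProcess.not_summable_aTwoTerm (hX : IsArrivalProcess P lam X)
    (hlam : ∀ j, 0 ≤ lam j) {c : ℕ} (hc : T < c) : ¬ Summable (aTwoTerm T (lam0 lam) c) := by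
  intro hs
  have h1 : ∀ n, 1 ≤ aTwoTerm T (lam0 lam) c n := by
    intro n
    rw [hX.aTwoTerm_eq_integral hlam, one_div, ← div_eq_inv_mul, le_div_iff₀ (by positivity)]
    have := integral_mono (integrable_const ((1 : ℝ) * ((n : ℝ) + 1)))
      (hX.integrable_max_sum_netSupply c (n + 1)) fun ω => by
        have h2 : ((n + 1 : ℕ) : ℤ) ≤ ∑ i ∈ Finset.range (n + 1), netSupply c (X ω i) := by
          have := Finset.card_nsmul_le_sum (Finset.range (n + 1))
            (fun i => netSupply c (X ω i)) 1 fun i _ => by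
              have := demand_le (X ω i)
              unfold netSupply
              omega
          simpa using this
        have h3 := (Int.cast_le (R := ℝ)).2 (h2.trans (le_max_left _ 0))
        push_cast at h3 ⊢
        rw [one_mul]
        exact h3
    simpa using this
  exact absurd (ge_of_tendsto' hs.tendsto_atTop_zero h1) (by norm_num)

/-- Spitzer's identity for the expected inventory carried over under constant orders. -/
theorem IsArrivalProcess.integral_lindley (hX : IsArrivalProcess P lam X)
    (hlam : ∀ j, 0 ≤ lam j) (c n : ℕ) :
    ∫ ω, (lindley (fun i => netSupply c (X ω i)) n : ℝ) ∂P =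
      ∑ k ∈ Finset.range n, aTwoTerm T (lam0 lam) c k := by
  induction n with
  | zero => simp [lindley]
  | succ m ih =>
    rw [Finset.sum_range_succ, ← ih]
    let F : ArrivalPath M T → ℝ := fun H => (lindley (fun i => netSupply c (H i)) (m + 1) : ℝ) -
      lindley (fun i => netSupply c (H (i + 1))) m
    have hdep1 : DependsOn (fun H : ArrivalPath M T =>
        (lindley (fun i => netSupply c (H (i + 1))) m : ℝ)) (Set.Iio (m + 1)) :=
      dependsOn_tailPath (dependsOn_lindley c m)
    have hF : DependsOn F (Set.Iio (m + 1)) := fun H H' h =>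
      congrArg₂ (· - ·) (dependsOn_lindley c (m + 1) h) (hdep1 h)
    have hFint : ∫ ω, F (X ω) ∂P =
        ∫ ω, (lindley (fun i => netSupply c (X ω i)) (m + 1) : ℝ) ∂P -
        ∫ ω, (lindley (fun i => netSupply c (X ω i)) m : ℝ) ∂P := by
      rw [← hX.integral_tail hlam (dependsOn_lindley c m)]
      exact integral_sub (hX.integrable (dependsOn_lindley c (m + 1))) (hX.integrable hdep1)
    -- All `m + 1` rotations of `F` have the same mean, so the mean gain is the mean positive part
    -- divided by `m + 1`.
    have hrot : ∑ i ∈ Finset.range (m + 1), ∫ ω, F (fun j => X ω ((j + i) % (m + 1))) ∂P =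
        ∫ ω, ((max (∑ i ∈ Finset.range (m + 1), netSupply c (X ω i)) 0 : ℤ) : ℝ) ∂P := by
      rw [← integral_finsetSum]
      · refine integral_congr_ae (.of_forall fun ω => ?_)
        have := sum_rotations_lindley (z := fun j => netSupply c (X ω (j % (m + 1)))) (m := m)
          fun j => by simp
        have h2 : ∑ i ∈ Finset.range (m + 1), netSupply c (X ω (i % (m + 1))) =
            ∑ i ∈ Finset.range (m + 1), netSupply c (X ω i) :=
          Finset.sum_congr rfl fun i hi => by rw [Nat.mod_eq_of_lt (Finset.mem_range.1 hi)]
        simp only [F]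
        rw [← h2, ← this]
        push_cast
        refine Finset.sum_congr rfl fun i _ => ?_
        simp only [add_assoc, add_comm 1 i]
      · intro i _
        exact hX.integrable (n := m + 1) (F := fun H => F fun j => H ((j + i) % (m + 1)))
          fun H H' h => hF fun j _ => h _ (Nat.mod_lt _ (Nat.succ_pos m))
    simp only [hX.integral_rotate hlam (Nat.succ_pos m) hF] at hrot
    rw [Finset.sum_const, Finset.card_range, nsmul_eq_mul] at hrot
    rw [hX.aTwoTerm_eq_integral hlam, ← hrot, hFint]
    push_cast
    field_simp
    ring

/-- The initial inventory `c` is the least possible one, and both the dynamics and the accepted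
reward are monotone in inventory. -/
theorem IsArrivalProcess.monotone_integral_acceptedReward (hX : IsArrivalProcess P lam X)
    (hlam : ∀ j, 0 ≤ lam j) (hlam_sum : ∑ j, lam j ≤ 1) {r : Fin M → ℝ} (hr : ∀ j, 0 < r j)
    (c : ℕ) : Monotone fun n => ∫ ω, acceptedReward r (constInv c (X ω) n) (X ω n) ∂P := by
  simp only [constInv_eq_chainState]
  have : ∀ n, ∫ ω, acceptedReward r (chainState (fun (I : ℤ) d => endInv I d + c) (c : ℤ) (X ω) n)
      (X ω n) ∂P = chainExp (cycleProb lam) (fun (I : ℤ) d => endInv I d + c)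
        (fun I d => acceptedReward r I d) n c := fun n =>
    hX.integral_chainState hlam (fun I d => acceptedReward r I d) n _
  simp only [this]
  refine chainExp_monotone (cycleProb_nonneg hlam hlam_sum) (sum_cycleProb lam)
    (R := fun I I' => 0 ≤ I ∧ I ≤ I') ?_ (fun I I' d h => acceptedReward_mono hr h.2 d) ?_
  · rintro I I' d ⟨h0, h1⟩
    rw [endInv_eq_max h0, endInv_eq_max (h0.trans h1)]
    omega
  · intro d
    have := endInv_nonneg (Int.natCast_nonneg c) d
    omega

/-- Long-run averages of a constant-order policy, according to convergence of the series. -/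
theorem IsArrivalProcess.constantOrder_dichotomy (hX : IsArrivalProcess P lam X)
    (hlam : ∀ j, 0 ≤ lam j) (hlam_sum : ∑ j, lam j ≤ 1) {r : Fin M → ℝ} (hr : ∀ j, 0 < r j)
    {h lo hi : ℝ} (hh : 0 < h) (hlo : ∀ j, lo ≤ r j) (hhi : ∀ j, r j ≤ hi) (c : ℕ) :
    (Summable (aTwoTerm T (lam0 lam) c) ∧
      (∃ v : ℝ, HasLongRunAverage P X (constProfit r h c) v ∧
        (∑ d : CycleArrivals M T, cycleProb lam d * totalReward r d) -
          aTwo T (lam0 lam) h hi c ≤ v ∧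
        v ≤ (∑ d : CycleArrivals M T, cycleProb lam d * totalReward r d) -
          aTwo T (lam0 lam) h lo c) ∧
      ∀ p : ℝ, 0 < p → HasLongRunAverage P X (constCost h p c) (aTwo T (lam0 lam) h p c : ℝ)) ∨
    (¬ Summable (aTwoTerm T (lam0 lam) c) ∧ HasLongRunAverage P X (constProfit r h c) ⊥ ∧
      ∀ p : ℝ, 0 < p → HasLongRunAverage P X (constCost h p c) ⊤) := by
  set R := ∑ d : CycleArrivals M T, cycleProb lam d * totalReward r d with hR
  set w : ℕ → ℝ := fun n => ∑ k ∈ Finset.range n, aTwoTerm T (lam0 lam) c k with hw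
  set g : ℕ → ℝ := fun n => ∫ ω, acceptedReward r (constInv c (X ω) n) (X ω n) ∂P with hg
  have hint : ∀ (f : ℤ → CycleArrivals M T → ℝ) n,
      Integrable (fun ω => f (constInv c (X ω) n) (X ω n)) P := fun f n =>
    hX.integrable (dependsOn_constInv c f n)
  have hlind : ∀ n, Integrable (fun ω => (lindley (fun i => netSupply c (X ω i)) n : ℝ)) P :=
    fun n => hX.integrable (dependsOn_lindley c n)
  have hwmono : Monotone w := monotone_nat_of_le_succ fun n => by
    simp only [hw, Finset.sum_range_succ]
    linarith [hX.aTwoTerm_nonneg hlam c n]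
  have hgmono : Monotone g := hX.monotone_integral_acceptedReward hlam hlam_sum hr c
  have hgR : ∀ n, g n ≤ R := fun n => by
    rw [hR, ← hX.integral_totalReward hlam r n]
    exact integral_mono (hint (fun I d => acceptedReward r I d) n)
      (hint (fun _ d => totalReward r d) n) fun ω => acceptedReward_le_totalReward hr _ _
  have hdep_profit : ∀ n, DependsOn (fun H : ArrivalPath M T => constProfit r h c H n)
      (Set.Iio (n + 1)) := fun n => dependsOn_constInv c (cycleProfit r h) n
  have hdep_cost : ∀ p n, DependsOn (fun H : ArrivalPath M T => constCost h p c H n)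
      (Set.Iio (n + 1)) := fun p n => dependsOn_constInv c (cycleLostSalesCost h p) n
  have hprofit : ∀ n, ∫ ω, constProfit r h c (X ω) n ∂P = g n + (-h) * w (n + 1) := fun n => by
    simp only [hg, hw]
    rw [← hX.integral_lindley hlam, ← integral_const_mul, ← integral_add
      (hint (fun I d => acceptedReward r I d) n) ((hlind (n + 1)).const_mul _)]
    refine integral_congr_ae (.of_forall fun ω => ?_)
    simp only [constProfit, cycleProfit_eq, endInv_constInv]
    ring
  have hdemand : ∀ n, ∫ ω, (demand (X ω n) : ℝ) ∂P = T * (1 - lam0 lam) := fun n => by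
    have hF : DependsOn (fun H : ArrivalPath M T => (demand (H 0) : ℝ)) (Set.Iio (0 + 1)) :=
      fun H H' h => by
        simp only
        rw [h 0 (by simp)]
    have := hX.integral_shift hlam hF n
    simp only [zero_add] at this
    rw [this, hX.integral_first_step hlam hF, ← sum_cycleProb_demand]
    simp [consPath]
  -- Conservation of units: sales are `c` minus the increase `w (n + 1) - w n` of the mean leftover,
  -- which vanishes in the limit when the series converges.
  have hcost : ∀ p n, ∫ ω, constCost h p c (X ω) n ∂P =
      h * w (n + 1) + p * (T * (1 - lam0 lam) - c + (w (n + 1) - w n)) := fun p n => by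
    simp only [hw]
    rw [← hX.integral_lindley hlam, ← hX.integral_lindley hlam, ← hdemand n,
      ← integral_sub (hlind (n + 1)) (hlind n)]
    have h1 : Integrable (fun ω => (demand (X ω n) : ℝ) - c) P :=
      hint (fun _ d => (demand d : ℝ) - c) n
    have hsub : Integrable (fun ω => (lindley (fun i => netSupply c (X ω i)) (n + 1) : ℝ) -
        lindley (fun i => netSupply c (X ω i)) n) P := (hlind (n + 1)).sub (hlind n)
    have hadd : Integrable (fun ω => p * ((demand (X ω n) : ℝ) - c +
        ((lindley (fun i => netSupply c (X ω i)) (n + 1) : ℝ) -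
          lindley (fun i => netSupply c (X ω i)) n))) P := (h1.add hsub).const_mul p
    have h2 : ∫ ω, (demand (X ω n) : ℝ) ∂P - c = ∫ ω, ((demand (X ω n) : ℝ) - c) ∂P := by
      rw [integral_sub (hint (fun _ d => (demand d : ℝ)) n) (integrable_const _)]
      simp
    rw [h2, ← integral_add h1 hsub, ← integral_const_mul,
      ← integral_const_mul, ← integral_add ((hlind (n + 1)).const_mul h)
      hadd]
    refine integral_congr_ae (.of_forall fun ω => ?_)
    have h3 : (sold (constInv c (X ω) n) (X ω n) : ℝ) =
        lindley (fun i => netSupply c (X ω i)) n + c -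
          lindley (fun i => netSupply c (X ω i)) (n + 1) := by
      rw [← endInv_constInv, endInv, constInv_eq_lindley]
      push_cast
      ring
    simp only [constCost, cycleLostSalesCost, endInv_constInv, h3]
    ring
  by_cases hs : Summable (aTwoTerm T (lam0 lam) c)
  · refine .inl ⟨hs, ?_⟩
    have hwlim : Tendsto w atTop (𝓝 (∑' n, aTwoTerm T (lam0 lam) c n)) :=
      hs.hasSum.tendsto_sum_nat
    have hwlim' := hwlim.comp (tendsto_add_atTop_nat 1)
    have hglim : Tendsto g atTop (𝓝 (⨆ n, g n)) :=
      tendsto_atTop_ciSup hgmono ⟨R, by rintro _ ⟨n, rfl⟩; exact hgR n⟩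
    have hcostlim : ∀ p, CesaroTendsto (fun n => ∫ ω, constCost h p c (X ω) n ∂P)
        (aTwo T (lam0 lam) h p c) := fun p => by
      refine .of_tendsto ?_
      simp only [hcost]
      have h1 := (hwlim'.const_mul h).add
        (((hwlim'.sub hwlim).const_add ((T : ℝ) * (1 - lam0 lam) - c)).const_mul p)
      have h2 : h * (∑' n, aTwoTerm T (lam0 lam) c n) + p * ((T : ℝ) * (1 - lam0 lam) - c +
          (∑' n, aTwoTerm T (lam0 lam) c n - ∑' n, aTwoTerm T (lam0 lam) c n)) =
          aTwo T (lam0 lam) h p c := by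
        rw [aTwo]
        ring
      rw [h2] at h1
      exact h1
    have hproflim : CesaroTendsto (fun n => ∫ ω, constProfit r h c (X ω) n ∂P)
        ((⨆ n, g n) + (-h) * ∑' n, aTwoTerm T (lam0 lam) c n) := by
      refine .of_tendsto ?_
      simp only [hprofit]
      exact hglim.add (hwlim'.const_mul (-h))
    have hcompare : ∀ p, CesaroTendsto (fun n => ∫ ω, (totalReward r (X ω n) -
        cycleLostSalesCost h p (constInv c (X ω) n) (X ω n)) ∂P)
        (R + (-1) * aTwo T (lam0 lam) h p c) := fun p => by
      refine ((CesaroTendsto.const R).add ((hcostlim p).const_mul (-1))).congr fun N => ?_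
      congr 1
      refine Finset.sum_congr rfl fun n _ => ?_
      simp only
      rw [integral_sub (hint (fun _ d => totalReward r d) n) (hint (cycleLostSalesCost h p) n),
        hX.integral_totalReward hlam r n, ← hR, neg_one_mul, ← sub_eq_add_neg]
      rfl
    refine ⟨⟨_, (hX.hasLongRunAverage_coe_iff hdep_profit _).2 hproflim, ?_, ?_⟩,
      fun p _ => (hX.hasLongRunAverage_coe_iff (hdep_cost p) _).2 (hcostlim p)⟩
    · have := (hcompare hi).le hproflim fun n =>
        integral_mono (hint (fun I d => totalReward r d - cycleLostSalesCost h hi I d) n)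
          (hint (cycleProfit r h) n) fun ω => le_cycleProfit hhi h _ _
      linarith
    · have := hproflim.le (hcompare lo) fun n =>
        integral_mono (hint (cycleProfit r h) n)
          (hint (fun I d => totalReward r d - cycleLostSalesCost h lo I d) n)
          fun ω => cycleProfit_le hlo h _ _
      linarith
  · refine .inr ⟨hs, ?_⟩
    have hwtop : Tendsto w atTop atTop :=
      (not_summable_iff_tendsto_nat_atTop_of_nonneg (hX.aTwoTerm_nonneg hlam c)).1 hs
    have havg := tendsto_average_atTop_of_monotone (a := fun n => w (n + 1))
      (fun i j hij => hwmono (by omega))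
      ((by simp [hw] : (0 : ℝ) = w 0).le.trans (hwmono (Nat.zero_le 1)))
      (hwtop.comp (tendsto_add_atTop_nat 1))
    -- The divergent holding cost dominates: the mean reward is at most `R` per cycle, and the
    -- penalty part of the cost is bounded below.
    have haffine : ∀ a : ℝ, Tendsto (fun N : ℕ => (1 / (N : ℝ)) *
        ∑ n ∈ Finset.range N, (a + h * w (n + 1))) atTop atTop := by
      intro a
      have h1 := Tendsto.add_atTop (CesaroTendsto.const a) (havg.const_mul_atTop hh)
      refine h1.congr fun N => ?_
      rw [Finset.sum_add_distrib, ← Finset.mul_sum]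
      ring
    constructor
    · rw [hX.hasLongRunAverage_iff hdep_profit, EReal.tendsto_coe_nhds_bot_iff]
      refine tendsto_atBot_mono (fun N => ?_) (tendsto_neg_atTop_atBot.comp (haffine (-R)))
      simp only [Function.comp_apply, hprofit]
      rw [← mul_neg, ← Finset.sum_neg_distrib]
      refine mul_le_mul_of_nonneg_left (Finset.sum_le_sum fun n _ => ?_) (by positivity)
      linarith [hgR n]
    · intro p hp
      rw [hX.hasLongRunAverage_iff (hdep_cost p), EReal.tendsto_coe_nhds_top_iff]
      refine tendsto_atTop_mono (fun N => ?_) (haffine (p * (T * (1 - lam0 lam) - c)))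
      simp only [hcost]
      refine mul_le_mul_of_nonneg_left (Finset.sum_le_sum fun n _ => ?_) (by positivity)
      have : 0 ≤ p * (w (n + 1) - w n) :=
        mul_nonneg hp.le (sub_nonneg.2 (hwmono (Nat.le_succ n)))
      linarith

end ConstantOrder

/-! ### Existence and comparison of optimal parameters -/

theorem exists_forall_ge_of_eventually {β : Type*} [LinearOrder β] (u : ℕ → β) {K : ℕ}
    (h : ∀ n, K < n → u n ≤ u 0) : ∃ z, ∀ n, u n ≤ u z := by
  obtain ⟨z, -, hz⟩ := Finset.exists_max_image (Finset.range (K + 1)) u ⟨0, by simp⟩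
  refine ⟨z, fun n => ?_⟩
  rcases le_or_gt n K with hn | hn
  · exact hz n (Finset.mem_range.2 (by omega))
  · exact (h n hn).trans (hz 0 (by simp))

section Optimal

variable {M T : ℕ} {Ω : Type*} [MeasurableSpace Ω] {P : Measure Ω} {X : Ω → ArrivalPath M T}
  {f : ℕ → ArrivalPath M T → ℕ → ℝ} {u : ℕ → EReal}

/-- If parameters beyond `K` do no better than `0`, the best of finitely many is optimal; uniqueness
of limits identifies each average with `u`. -/
theorem exists_isProfitOptimal (hu : ∀ z, HasLongRunAverage P X (f z) (u z)) {K : ℕ}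
    (h : ∀ n, K < n → u n ≤ u 0) : ∃ z, IsProfitOptimal P X f z := by
  obtain ⟨z, hz⟩ := exists_forall_ge_of_eventually u h
  refine ⟨z, u z, hu z, fun z' w hw => ?_⟩
  rw [tendsto_nhds_unique hw (hu z')]
  exact hz z'

theorem exists_isCostOptimal (hu : ∀ z, HasLongRunAverage P X (f z) (u z)) {K : ℕ}
    (h : ∀ n, K < n → u 0 ≤ u n) : ∃ z, IsCostOptimal P X f z := by
  obtain ⟨z, hz⟩ := exists_forall_ge_of_eventually (β := ERealᵒᵈ) u h
  refine ⟨z, u z, hu z, fun z' w hw => ?_⟩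
  rw [tendsto_nhds_unique hw (hu z')]
  exact hz z'

theorem IsProfitOptimal.le (hu : ∀ z, HasLongRunAverage P X (f z) (u z)) {z : ℕ}
    (hz : IsProfitOptimal P X f z) (z' : ℕ) : u z' ≤ u z := by
  obtain ⟨v, hv, hmax⟩ := hz
  rw [← tendsto_nhds_unique hv (hu z)]
  exact hmax z' _ (hu z')

theorem IsCostOptimal.le (hu : ∀ z, HasLongRunAverage P X (f z) (u z)) {z : ℕ}
    (hz : IsCostOptimal P X f z) (z' : ℕ) : u z ≤ u z' := by
  obtain ⟨v, hv, hmin⟩ := hz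
  rw [← tendsto_nhds_unique hv (hu z)]
  exact hmin z' _ (hu z')

end Optimal

theorem summable_aTwoTerm_zero (T : ℕ) (l0 : ℝ) : Summable (aTwoTerm T l0 0) := by
  have : aTwoTerm T l0 0 = fun _ => 0 := by
    funext n
    simp [aTwoTerm]
  rw [this]
  exact summable_zero

end Replenishment

/-! ### The main theorem -/

open Replenishment
theorem mainTheorem3
    (M T L : ℕ) (hM : 2 ≤ M) (hT : 1 ≤ T) (hL : 1 ≤ L)
    (r : Fin M → ℝ) (hr : StrictMono r) (hr_pos : ∀ j, 0 < r j)
    (lam : Fin M → ℝ) (hlam : ∀ j, 0 ≤ lam j) (hlam_sum : ∑ j, lam j ≤ 1)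
    (h : ℝ) (hh : 0 < h)
    {Ω : Type*} [MeasurableSpace Ω] (P : Measure Ω) [IsProbabilityMeasure P]
    (X : Ω → ArrivalPath M T) (hX : IsArrivalProcess P lam X)
    (init : ℕ → StockState) (hinit : ∀ S, (init S).Feasible L S)
    (r₁ rM : ℝ) (hr₁ : r₁ = r ⟨0, by omega⟩) (hrM : rM = r ⟨M - 1, by omega⟩) :
    -- the long-run averages exist
    (∀ S, ∃ v : ℝ, HasLongRunAverage P X (baseProfit r h L init S) v) ∧
    (∀ c, ∃ v : EReal, v ≠ ⊤ ∧ HasLongRunAverage P X (constProfit r h c) v) ∧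
    (∀ b : ℝ, 0 < b → ∀ S, ∃ v : ℝ, HasLongRunAverage P X (backorderCost h b L init S) v) ∧
    (∀ p : ℝ, 0 < p → ∀ c, ∃ v : EReal, v ≠ ⊥ ∧ HasLongRunAverage P X (constCost h p c) v) ∧
    -- the optimal policy parameters exist
    (∃ S, IsProfitOptimal P X (baseProfit r h L init) S) ∧
    (∃ c, IsProfitOptimal P X (constProfit r h) c) ∧
    (∀ b : ℝ, 0 < b → ∃ S, IsCostOptimal P X (backorderCost h b L init) S) ∧
    (∀ p : ℝ, 0 < p → ∃ c, IsCostOptimal P X (constCost h p) c) ∧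
    -- the bounds, for every choice of optimal parameters
    (∀ Soff coff SBar SUnder c₁ cM : ℕ,
      IsProfitOptimal P X (baseProfit r h L init) Soff →
      IsProfitOptimal P X (constProfit r h) coff →
      IsCostOptimal P X (backorderCost h (rM + L * h) L init) SBar →
      IsCostOptimal P X (backorderCost h (r₁ / (L + 1)) L init) SUnder →
      IsCostOptimal P X (constCost h r₁) c₁ →
      IsCostOptimal P X (constCost h rM) cM →
      Summable (aTwoTerm T (lam0 lam) c₁) ∧
      Summable (aTwoTerm T (lam0 lam) cM) ∧
      ∃ πb πc : ℝ,
        HasLongRunAverage P X (baseProfit r h L init Soff) πb ∧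
        HasLongRunAverage P X (constProfit r h coff) πc ∧
        aTwo T (lam0 lam) h r₁ c₁ - aBarOne T (lam0 lam) h rM L SBar ≤ πb - πc ∧
        πb - πc ≤ aTwo T (lam0 lam) h rM cM - aUnderOne T (lam0 lam) h r₁ L SUnder) := by
  have hr₁_pos : 0 < r₁ := hr₁ ▸ hr_pos _
  have hrM_pos : 0 < rM := hrM ▸ hr_pos _
  have hlo : ∀ j, r₁ ≤ r j := fun j => hr₁ ▸ hr.monotone (Fin.mk_le_of_le_val (Nat.zero_le _))
  have hhi : ∀ j, r j ≤ rM := fun j => by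
    rw [hrM]
    exact hr.monotone (Fin.le_def.2 (Nat.le_sub_one_of_lt j.2))
  choose vb hvb hvb_lo hvb_hi hvb_bdd using fun S =>
    hX.exists_baseProfit hlam hlam_sum hL (hinit S) hh hr₁_pos hlo hrM_pos hhi
  have hB : ∀ b S, HasLongRunAverage P X (backorderCost h b L init S)
      (backorderValue T (lam0 lam) h b L S : ℝ) := fun b S =>
    hX.hasLongRunAverage_backorderCost hlam hL h b init
  have hdich := hX.constantOrder_dichotomy hlam hlam_sum hr_pos hh hlo hhi
  have hc : ∀ c, ∃ v : EReal, v ≠ ⊤ ∧ HasLongRunAverage P X (constProfit r h c) v ∧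
      (¬ Summable (aTwoTerm T (lam0 lam) c) → v = ⊥) := fun c => by
    rcases hdich c with ⟨hs, ⟨v, hv, -⟩, -⟩ | ⟨-, hv, -⟩
    · exact ⟨v, EReal.coe_ne_top v, hv, fun hs' => absurd hs hs'⟩
    · exact ⟨⊥, bot_ne_top, hv, fun _ => rfl⟩
  have hk : ∀ p : ℝ, 0 < p → ∀ c, ∃ v : EReal, v ≠ ⊥ ∧ HasLongRunAverage P X (constCost h p c) v ∧
      (¬ Summable (aTwoTerm T (lam0 lam) c) → v = ⊤) ∧
      (Summable (aTwoTerm T (lam0 lam) c) → v = (aTwo T (lam0 lam) h p c : ℝ)) := fun p hp c => by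
    rcases hdich c with ⟨hs, -, hv⟩ | ⟨hs, -, hv⟩
    · exact ⟨_, EReal.coe_ne_bot _, hv p hp, fun hs' => absurd hs hs', fun _ => rfl⟩
    · exact ⟨⊤, top_ne_bot, hv p hp, fun _ => rfl, fun hs' => absurd hs' hs⟩
  choose vc hvc_top hvc hvc_bot using hc
  choose vk hvk_bot hvk hvk_top hvk_eq using hk
  have hlarge : ∀ a : ℝ, ∃ K : ℕ, ∀ S : ℕ, K < S → a ≤ h * ((S : ℝ) - (L + 1) * T) := fun a => by
    obtain ⟨K, hK⟩ := exists_nat_ge (a / h + (L + 1) * T)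
    refine ⟨K, fun S hS => ?_⟩
    have h1 : (K : ℝ) ≤ S := by exact_mod_cast hS.le
    rw [← div_le_iff₀' hh]
    linarith
  -- Ordering nothing has finite cost, so a cost-optimal quantity cannot have a divergent series.
  have hsum_of_opt : ∀ (p : ℝ) (hp : 0 < p) (c : ℕ), IsCostOptimal P X (constCost h p) c →
      Summable (aTwoTerm T (lam0 lam) c) := fun p hp c hopt => by
    by_contra hs
    have := hopt.le (hvk p hp) 0
    rw [hvk_top p hp c hs, hvk_eq p hp 0 (summable_aTwoTerm_zero _ _), top_le_iff] at this
    exact EReal.coe_ne_top _ this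
  refine ⟨fun S => ⟨vb S, hvb S⟩, fun c => ⟨vc c, hvc_top c, hvc c⟩, fun b _ S => ⟨_, hB b S⟩,
    fun p hp c => ⟨vk p hp c, hvk_bot p hp c, hvk p hp c⟩, ?_, ?_, ?_, ?_, ?_⟩
  · obtain ⟨K, hK⟩ := hlarge
      ((∑ d : CycleArrivals M T, cycleProb lam d * totalReward r d) - vb 0)
    exact exists_isProfitOptimal hvb fun S hS => EReal.coe_le_coe_iff.2 (by
      linarith [hvb_bdd S, hK S hS])
  · exact exists_isProfitOptimal hvc (K := T) fun c hcT => by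
      rw [hvc_bot c (hX.not_summable_aTwoTerm hlam hcT)]
      exact bot_le
  · intro b hb
    obtain ⟨K, hK⟩ := hlarge (backorderValue T (lam0 lam) h b L 0)
    exact exists_isCostOptimal (hB b) fun S hS => EReal.coe_le_coe_iff.2
      ((hK S hS).trans (hX.le_backorderValue hlam hh hb))
  · intro p hp
    exact exists_isCostOptimal (hvk p hp) (K := T) fun c hcT => by
      rw [hvk_top p hp c (hX.not_summable_aTwoTerm hlam hcT)]
      exact le_top
  · intro Soff coff SBar SUnder c₁ cM hSoff hcoff hSBar hSUnder hc₁ hcM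
    have hs₁ := hsum_of_opt r₁ hr₁_pos c₁ hc₁
    have hsM := hsum_of_opt rM hrM_pos cM hcM
    have hsoff : Summable (aTwoTerm T (lam0 lam) coff) := by
      by_contra hs
      have := hcoff.le hvc 0
      rw [hvc_bot coff hs, le_bot_iff] at this
      rcases hdich 0 with ⟨-, ⟨v, hv, -⟩, -⟩ | ⟨hs0, -⟩
      · rw [tendsto_nhds_unique (hvc 0) hv] at this
        exact EReal.coe_ne_bot v this
      · exact hs0 (summable_aTwoTerm_zero _ _)
    obtain ⟨-, ⟨πc, hπc, -, hπc_le⟩, -⟩ := (hdich coff).resolve_right fun h' => h'.1 hsoff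
    obtain ⟨-, ⟨v, hv, hv_le, -⟩, -⟩ := (hdich cM).resolve_right fun h' => h'.1 hsM
    have h1 : vb SBar ≤ vb Soff := EReal.coe_le_coe_iff.1 (hSoff.le hvb SBar)
    have h2 : v ≤ πc := by
      have := hcoff.le hvc cM
      rw [tendsto_nhds_unique (hvc cM) hv, tendsto_nhds_unique (hvc coff) hπc] at this
      exact EReal.coe_le_coe_iff.1 this
    have h3 : aTwo T (lam0 lam) h r₁ c₁ ≤ aTwo T (lam0 lam) h r₁ coff := by
      have := hc₁.le (hvk r₁ hr₁_pos) coff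
      rw [hvk_eq r₁ hr₁_pos c₁ hs₁, hvk_eq r₁ hr₁_pos coff hsoff] at this
      exact EReal.coe_le_coe_iff.1 this
    have h4 : backorderValue T (lam0 lam) h (r₁ / (L + 1)) L SUnder ≤
        backorderValue T (lam0 lam) h (r₁ / (L + 1)) L Soff :=
      EReal.coe_le_coe_iff.1 (hSUnder.le (hB _) Soff)
    -- Lower bound: `Soff` earns at least as much as `SBar`, and `coff` costs at least as much as
    -- `c₁` under penalty `r₁`. Upper bound: `coff` earns at least as much as `cM`, and `Soff` costs
    -- at least as much as `SUnder` in the backorder system with penalty `r₁ / (L + 1)`.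
    refine ⟨hs₁, hsM, vb Soff, πc, hvb Soff, hπc, ?_, ?_⟩
    · have h5 := hvb_lo SBar
      change _ - aBarOne T (lam0 lam) h rM L SBar ≤ _ at h5
      linarith
    · have h5 := hvb_hi Soff
      change aUnderOne T (lam0 lam) h r₁ L SUnder ≤ _ at h4
      linarith
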